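/- Let $p$ be a prime, $k$ a field of characteristic $p$, and $H=k[X]/(X^p)$ the Hopf algebra with $\Delta(X)=X\otimes 1+1\otimes X$ and $\varepsilon(X)=0$, graded with $X$ in degree $1$. Let $\mathcal H'$ be the stable category of finite-dimensional $\mathbb Z$-graded $H$-modules, i.e. the quotient of the category of finite-dimensional $\mathbb Z$-graded $H$-modules and degree-preserving $H$-linear maps by the ideal of morphisms that factor through a projective module. With $\Lambda=X^{p-1}$ and $M\{j\}$ the grading shift of $M$ upward by $j$, its translation functor is $TM=(H/k\Lambda)\{1-p\}\otimes_k M$, and its distinguished triangles are the sextuples $X\to Y\to Z\to TX$ isomorphic in $\mathcal H'$ to a standard one $X\xrightarrow{u}Y\to C_u\to TX$, where $u$ is a morphism of graded modules, $C_u$ is the pushout of $u$ and the embedding $X\to H\{1-p\}\otimes_k X$, $x\mapsto \Lambda\otimes x$, and $C_u\to TX$ is induced by the quotient map $H\{1-p\}\otimes_k X\to TX$ and by $0\colon Y\to TX$. Let $K(\mathcal H')$ be the Grothendieck group: the abelian group with generators $[M]$ for the objects $M$ of $\mathcal H'$ and relations $[Y]=[X]+[Z]$ for the distinguished triangles $X\to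 Y\to Z\to TX$. Then $K(\mathcal H')$ is naturally isomorphic to the ring $R_p=\mathbb Z[q]/(1+q+\dots+q^{p-1})$, with multiplication by $q$ corresponding to the grading shift. Precisely, there is a unique isomorphism of abelian groups $\varphi\colon K(\mathcal H')\to R_p$ such that $\varphi([\mathbf 1])=1$, where $\mathbf 1=k$ is the trivial module in degree $0$, and, for all finite-dimensional graded $H$-modules $M$ and $N$, $\varphi([M\otimes_k N])=\varphi([M])\,\varphi([N])$ and $\varphi([M\{1\}])=q\,\varphi([M])$. -/

import Mathlib

open CategoryTheory
open scoped TensorProduct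

universe u

noncomputable section

namespace KStable

/-! ### Gradings of vector spaces -/

section Gradings

variable {k : Type u} [Field k] {V W : Type u} [AddCommGroup V] [Module k V]
  [AddCommGroup W] [Module k W]

/-- Criterion for a family of subspaces to be a grading: it spans, and there is a linear map
`v ↦ ∑ vₙ tⁿ` sending every `v` in the `n`-th subspace to `v tⁿ`. -/
theorem isInternal_of_coaction (A : ℤ → Submodule k V) (hs : iSup A = ⊤)
    (d : V →ₗ[k] (ℤ →₀ V)) (hd : ∀ n, ∀ v ∈ A n, d v = Finsupp.single n v) :
    DirectSum.IsInternal A := by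
  constructor
  · have key : ∀ x : DirectSum ℤ (fun i => A i), ∀ n : ℤ,
        d (DirectSum.coeAddMonoidHom A x) n = (x n : V) := by
      intro x n
      induction x using DirectSum.induction_on with
      | zero => simp
      | of i v =>
        rw [DirectSum.coeAddMonoidHom_of, hd i _ v.2, Finsupp.single_apply,
          DirectSum.coe_of_apply]
        split_ifs <;> simp
      | add x y hx hy => simp [map_add, hx, hy]
    intro x y hxy
    ext n
    rw [← key x n, ← key y n, hxy]
  · intro v
    have hv : v ∈ iSup A := hs ▸ Submodule.mem_top
    induction hv using Submodule.iSup_induction' with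
    | mem i v hv => exact ⟨DirectSum.of (fun i => A i) i ⟨v, hv⟩, by simp⟩
    | zero => exact ⟨0, by simp⟩
    | add x y _ _ hx hy =>
      obtain ⟨a, ha⟩ := hx
      obtain ⟨b, hb⟩ := hy
      exact ⟨a + b, by rw [map_add, ha, hb]⟩

theorem exists_coaction {A : ℤ → Submodule k V} (h : DirectSum.IsInternal A) :
    ∃ d : V →ₗ[k] (ℤ →₀ V), (∀ n, ∀ v ∈ A n, d v = Finsupp.single n v) ∧
      ∀ v n, d v n ∈ A n := by
  let e := LinearEquiv.ofBijective (DirectSum.coeLinearMap A) h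
  obtain ⟨s, hs1⟩ : ∃ s : DirectSum ℤ (fun i => A i) →ₗ[k] (ℤ →₀ V),
      ∀ i (v : A i), s (DirectSum.lof k ℤ (fun i => A i) i v) = Finsupp.single i (v : V) :=
    ⟨DirectSum.toModule k ℤ (ℤ →₀ V) (fun i => (Finsupp.lsingle i : V →ₗ[k] _) ∘ₗ (A i).subtype),
      fun i v => by rw [DirectSum.toModule_lof]; rfl⟩
  have hs : ∀ (x : DirectSum ℤ (fun i => A i)) (n : ℤ), s x n = (x n : V) := by
    intro x n
    induction x using DirectSum.induction_on with
    | zero => simp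
    | of i v =>
      rw [← DirectSum.lof_eq_of k, hs1, Finsupp.single_apply, DirectSum.lof_eq_of,
        DirectSum.coe_of_apply]
      split_ifs <;> simp
    | add x y hx hy => simp [map_add, hx, hy]
  refine ⟨s.comp e.symm.toLinearMap, ?_, ?_⟩
  · intro n v hv
    have he : e (DirectSum.lof k ℤ (fun i => A i) n ⟨v, hv⟩) = v :=
      DirectSum.coeLinearMap_lof A n ⟨v, hv⟩
    have hes : e.symm v = DirectSum.lof k ℤ (fun i => A i) n ⟨v, hv⟩ := by
      rw [LinearEquiv.symm_apply_eq, he]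
    rw [LinearMap.comp_apply, LinearEquiv.coe_coe, hes, hs1]
  · intro v n
    rw [LinearMap.comp_apply, hs]
    exact Subtype.property _

/-- The total grading of a tensor product: degree `n` is spanned by the `v ⊗ w` with
`deg v + deg w = n`. -/
def tensorDeg (A : ℤ → Submodule k V) (B : ℤ → Submodule k W) (n : ℤ) :
    Submodule k (V ⊗[k] W) :=
  Submodule.span k {t | ∃ i j : ℤ, i + j = n ∧ ∃ v ∈ A i, ∃ w ∈ B j, v ⊗ₜ[k] w = t}

theorem tmul_mem_tensorDeg {A : ℤ → Submodule k V} {B : ℤ → Submodule k W} {i j n : ℤ}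
    (h : i + j = n) {v : V} (hv : v ∈ A i) {w : W} (hw : w ∈ B j) :
    v ⊗ₜ[k] w ∈ tensorDeg A B n :=
  Submodule.subset_span ⟨i, j, h, v, hv, w, hw, rfl⟩

theorem isInternal_tensorDeg {A : ℤ → Submodule k V} {B : ℤ → Submodule k W}
    (hA : DirectSum.IsInternal A) (hB : DirectSum.IsInternal B) :
    DirectSum.IsInternal (tensorDeg A B) := by
  obtain ⟨d, hd, -⟩ := exists_coaction hA
  obtain ⟨e, he, -⟩ := exists_coaction hB
  refine isInternal_of_coaction _ ?_
    ((Finsupp.lmapDomain (V ⊗[k] W) k (fun x : ℤ × ℤ => x.1 + x.2)).comp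
      ((finsuppTensorFinsupp k k V W ℤ ℤ).toLinearMap.comp (TensorProduct.map d e))) ?_
  · rw [eq_top_iff, ← TensorProduct.span_tmul_eq_top, Submodule.span_le]
    rintro _ ⟨v, w, rfl⟩
    have hv : v ∈ iSup A := hA.submodule_iSup_eq_top ▸ Submodule.mem_top
    have hw : w ∈ iSup B := hB.submodule_iSup_eq_top ▸ Submodule.mem_top
    change v ⊗ₜ[k] w ∈ iSup (tensorDeg A B)
    induction hv using Submodule.iSup_induction' with
    | mem i v hv =>
      induction hw using Submodule.iSup_induction' with
      | mem j w hw =>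
        exact Submodule.mem_iSup_of_mem (i + j) (tmul_mem_tensorDeg rfl hv hw)
      | zero => simp
      | add x y _ _ hx hy => rw [TensorProduct.tmul_add]; exact add_mem hx hy
    | zero => simp
    | add x y _ _ hx hy => rw [TensorProduct.add_tmul]; exact add_mem hx hy
  · intro n t ht
    induction ht using Submodule.span_induction with
    | mem t ht =>
      obtain ⟨i, j, rfl, v, hv, w, hw, rfl⟩ := ht
      simp [hd i v hv, he j w hw]
    | zero => simp
    | add x y _ _ hx hy => rw [map_add, hx, hy, Finsupp.single_add]
    | smul c x _ hx => rw [map_smul, hx, Finsupp.smul_single]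

/-- The image of a grading under a surjective linear map with homogeneous kernel is a grading. -/
theorem isInternal_map {A : ℤ → Submodule k V} (hA : DirectSum.IsInternal A) (f : V →ₗ[k] W)
    (hf : Function.Surjective f) (K : Set V) (hK : LinearMap.ker f = Submodule.span k K)
    (hKA : ∀ x ∈ K, ∃ n, x ∈ A n) : DirectSum.IsInternal (fun n => (A n).map f) := by
  obtain ⟨d, hd, -⟩ := exists_coaction hA
  let fd : V →ₗ[k] (ℤ →₀ W) := (Finsupp.mapRange.linearMap f).comp d
  have hker : LinearMap.ker f ≤ LinearMap.ker fd := by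
    rw [hK, Submodule.span_le]
    intro x hx
    obtain ⟨n, hn⟩ := hKA x hx
    have hfx : f x = 0 := by
      have : x ∈ LinearMap.ker f := hK ▸ Submodule.subset_span hx
      exact this
    simp [fd, hd n x hn, hfx]
  obtain ⟨g, hg⟩ := (LinearMap.exists_rightInverse_of_surjective f (LinearMap.range_eq_top.2 hf))
  have hfd : ∀ v, fd (g (f v)) = fd v := by
    intro v
    rw [← sub_eq_zero, ← map_sub]
    apply hker
    rw [LinearMap.mem_ker, map_sub, sub_eq_zero]
    exact LinearMap.congr_fun hg (f v)
  refine isInternal_of_coaction _ ?_ (fd.comp g) ?_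
  · rw [← Submodule.map_iSup, hA.submodule_iSup_eq_top, Submodule.map_top,
      LinearMap.range_eq_top.2 hf]
  · rintro n _ ⟨v, hv, rfl⟩
    rw [LinearMap.comp_apply, hfd]
    simp [fd, hd n v hv]

end Gradings

/-! ### The graded Hopf algebra `H = k[X]/(X ^ p)` -/

section HopfAlgebra

variable (k : Type u) [Field k] (p : ℕ)

/-- The algebra `H = k[X]/(X ^ p)`. -/
abbrev H : Type u := AdjoinRoot (Polynomial.X ^ p : Polynomial k)

/-- The class of `X` in `H`. -/
def xH : H k p := AdjoinRoot.root _

/-- The grading of `H`, with `X` in degree `1`. -/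
def hDeg (i : ℤ) : Submodule k (H k p) := Submodule.span k {h | ∃ n : ℕ, (n : ℤ) = i ∧ xH k p ^ n = h}

theorem xH_pow : xH k p ^ p = 0 := by
  have h := AdjoinRoot.mk_self (f := (Polynomial.X ^ p : Polynomial k))
  rwa [map_pow, AdjoinRoot.mk_X] at h

theorem xH_pow_mem (n : ℕ) : xH k p ^ n ∈ hDeg k p n := Submodule.subset_span ⟨n, rfl, rfl⟩

theorem span_xH_pow : Submodule.span k (Set.range fun n : ℕ => xH k p ^ n) = ⊤ := by
  rw [eq_top_iff]
  rintro x -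
  induction x using AdjoinRoot.induction_on with
  | ih f =>
    induction f using Polynomial.induction_on' with
    | add f g hf hg => rw [map_add]; exact add_mem hf hg
    | monomial n a =>
      rw [← Polynomial.C_mul_X_pow_eq_monomial, ← Polynomial.smul_eq_C_mul, ← AdjoinRoot.smul_mk,
        map_pow, AdjoinRoot.mk_X]
      exact Submodule.smul_mem _ _ (Submodule.subset_span ⟨n, rfl⟩)

theorem isInternal_hDeg [Fact p.Prime] : DirectSum.IsInternal (hDeg k p) := by
  let D : H k p →ₐ[k] AddMonoidAlgebra (H k p) ℤ :=
    AdjoinRoot.liftAlgHom _ (Algebra.ofId k _) (AddMonoidAlgebra.single 1 (xH k p)) (by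
      rw [Polynomial.eval₂_X_pow, AddMonoidAlgebra.single_pow, xH_pow]
      exact AddMonoidAlgebra.single_zero _)
  have hD : ∀ n : ℕ, D (xH k p ^ n) = AddMonoidAlgebra.single (n : ℤ) (xH k p ^ n) := by
    intro n
    rw [map_pow, xH, AdjoinRoot.liftAlgHom_root, AddMonoidAlgebra.single_pow]
    simp [xH]
  refine isInternal_of_coaction _ ?_
    ((AddMonoidAlgebra.coeffLinearEquiv k).toLinearMap.comp D.toLinearMap) ?_
  · rw [eq_top_iff, ← span_xH_pow, Submodule.span_le]
    rintro _ ⟨n, rfl⟩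
    exact Submodule.mem_iSup_of_mem (n : ℤ) (xH_pow_mem k p n)
  · intro n t ht
    induction ht using Submodule.span_induction with
    | mem t ht =>
      obtain ⟨m, rfl, rfl⟩ := ht
      change (D (xH k p ^ m)).coeff = _
      rw [hD]
      rfl
    | zero => simp
    | add x y _ _ hx hy => rw [map_add, hx, hy, Finsupp.single_add]
    | smul c x _ hx => rw [map_smul, hx, Finsupp.smul_single]

instance finite_H [Fact p.Prime] : Module.Finite k (H k p) :=
  (Polynomial.monic_X_pow p).finite_adjoinRoot

section Structure

variable [Fact p.Prime]

/-- The comultiplication `Δ : H → H ⊗ H` with `Δ X = X ⊗ 1 + 1 ⊗ X`. -/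
def comulH [CharP k p] : H k p →ₐ[k] H k p ⊗[k] H k p :=
  AdjoinRoot.liftAlgHom _ (Algebra.ofId k _) (xH k p ⊗ₜ 1 + 1 ⊗ₜ xH k p) (by
    obtain ⟨r, hr⟩ := exists_add_pow_prime_eq (R := H k p ⊗[k] H k p)
      (Fact.out : p.Prime)
      (xH k p ⊗ₜ[k] 1) (1 ⊗ₜ[k] xH k p)
    have h0 : (p : H k p ⊗[k] H k p) = 0 := by
      rw [← map_natCast (algebraMap k (H k p ⊗[k] H k p)), CharP.cast_eq_zero, map_zero]
    rw [Polynomial.eval₂_X_pow, hr, h0]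
    simp [xH_pow])

theorem comulH_xH [CharP k p] : comulH k p (xH k p) = xH k p ⊗ₜ 1 + 1 ⊗ₜ xH k p :=
  AdjoinRoot.liftAlgHom_root _ _ _ _

/-- The counit `ε : H → k` with `ε X = 0`. -/
def counitH : H k p →ₐ[k] k :=
  AdjoinRoot.liftAlgHom _ (Algebra.ofId k _) 0 (by
    rw [Polynomial.eval₂_X_pow, zero_pow (Fact.out : p.Prime).ne_zero])

/-- The left integral `Λ = X ^ (p - 1)` of `H`; it spans the ideal of elements killed by `X`. -/
def integralH : H k p := xH k p ^ (p - 1)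

theorem xH_mul_integralH : xH k p * integralH k p = 0 := by
  rw [integralH, ← pow_succ', Nat.sub_add_cancel (Fact.out : p.Prime).one_le, xH_pow]

end Structure

end HopfAlgebra

/-! ### The action of `H` on a tensor product -/

section Action

variable {k : Type u} [Field k] {p : ℕ}

/-- A `k`-linear map commuting with `X` is `H`-linear. -/
def linearOfX {V W : Type u} [AddCommGroup V] [Module k V] [Module (H k p) V]
    [IsScalarTower k (H k p) V] [AddCommGroup W] [Module k W] [Module (H k p) W]
    [IsScalarTower k (H k p) W] (f : V →ₗ[k] W) (hf : ∀ v, f (xH k p • v) = xH k p • f v) :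
    V →ₗ[H k p] W where
  toFun := f
  map_add' := map_add f
  map_smul' h v := by
    have hn : ∀ (n : ℕ) (v : V), f (xH k p ^ n • v) = xH k p ^ n • f v := by
      intro n
      induction n with
      | zero => simp
      | succ n ih => intro v; rw [pow_succ, mul_smul, ih, hf, mul_smul]
    have hh : h ∈ Submodule.span k (Set.range fun n : ℕ => xH k p ^ n) :=
      span_xH_pow k p ▸ Submodule.mem_top
    rw [RingHom.id_apply]
    induction hh using Submodule.span_induction with
    | mem h hh => obtain ⟨n, rfl⟩ := hh; exact hn n v
    | zero => simp
    | add a b _ _ ha hb => rw [add_smul, map_add, ha, hb, add_smul]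
    | smul c a _ ha => rw [smul_assoc, map_smul, ha, smul_assoc]

variable (V W : Type u) [AddCommGroup V] [Module k V] [Module (H k p) V]
    [IsScalarTower k (H k p) V] [AddCommGroup W] [Module k W] [Module (H k p) W]
    [IsScalarTower k (H k p) W] [Fact p.Prime] [CharP k p]

/-- The action of `H` on `V ⊗ W` through the comultiplication. -/
def tensorAction : H k p →ₐ[k] Module.End k (V ⊗[k] W) :=
  (Module.endTensorEndAlgHom (R := k) (S := k) (A := k) (M := V) (N := W)).comp
    ((Algebra.TensorProduct.map (Algebra.lsmul k k V) (Algebra.lsmul k k W)).comp (comulH k p))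

theorem tensorAction_xH (v : V) (w : W) :
    tensorAction V W (xH k p) (v ⊗ₜ w) = (xH k p • v) ⊗ₜ w + v ⊗ₜ (xH k p • w) := by
  change Module.endTensorEndAlgHom (R := k) (S := k) (A := k) (M := V) (N := W)
    (Algebra.TensorProduct.map (Algebra.lsmul k k V) (Algebra.lsmul k k W)
      (comulH k p (xH k p))) (v ⊗ₜ w) = _
  rw [comulH_xH, map_add, map_add, Algebra.TensorProduct.map_tmul, Algebra.TensorProduct.map_tmul,
    Module.endTensorEndAlgHom_apply, Module.endTensorEndAlgHom_apply]
  simp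

variable {V W} in
theorem tensorAction_mem {A : ℤ → Submodule k V} {B : ℤ → Submodule k W}
    (hA : ∀ j, ∀ v ∈ A j, xH k p • v ∈ A (1 + j)) (hB : ∀ j, ∀ v ∈ B j, xH k p • v ∈ B (1 + j))
    (n : ℤ) (t : V ⊗[k] W) (ht : t ∈ tensorDeg A B n) :
    tensorAction V W (xH k p) t ∈ tensorDeg A B (1 + n) := by
  induction ht using Submodule.span_induction with
  | mem t ht =>
    obtain ⟨i, j, rfl, v, hv, w, hw, rfl⟩ := ht
    rw [tensorAction_xH]
    exact add_mem (tmul_mem_tensorDeg (by ring) (hA _ _ hv) hw)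
      (tmul_mem_tensorDeg (by ring) hv (hB _ _ hw))
  | zero => rw [map_zero]; exact Submodule.zero_mem _
  | add a b _ _ ha hb => rw [map_add]; exact add_mem ha hb
  | smul c a _ ha => rw [map_smul]; exact Submodule.smul_mem _ _ ha

variable {V W} in
theorem tensorAction_smul (c : k) (h : H k p) (t : V ⊗[k] W) :
    tensorAction V W (c • h) t = c • tensorAction V W h t := by
  rw [map_smul, LinearMap.smul_apply]

/-- The space `V ⊗ W`, with the action of `H` through the comultiplication. -/
def DiagTensor (k : Type u) [Field k] (V W : Type u) [AddCommGroup V] [Module k V]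
    [AddCommGroup W] [Module k W] : Type u := V ⊗[k] W

instance : AddCommGroup (DiagTensor k V W) := inferInstanceAs (AddCommGroup (V ⊗[k] W))

instance : Module k (DiagTensor k V W) := inferInstanceAs (Module k (V ⊗[k] W))

instance [Module.Finite k V] [Module.Finite k W] : Module.Finite k (DiagTensor k V W) :=
  inferInstanceAs (Module.Finite k (V ⊗[k] W))

instance : Module (H k p) (DiagTensor k V W) :=
  Module.compHom (V ⊗[k] W) (tensorAction V W).toRingHom

instance : IsScalarTower k (H k p) (DiagTensor k V W) :=
  ⟨fun c h t => tensorAction_smul (V := V) (W := W) c h t⟩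

end Action

/-! ### Finite-dimensional graded `H`-modules -/

/-- Finite-dimensional `ℤ`-graded modules over the graded algebra `H`. -/
structure GMod (k : Type u) [Field k] (p : ℕ) where
  carrier : Type u
  [addCommGroup : AddCommGroup carrier]
  [moduleBase : Module k carrier]
  [moduleH : Module (H k p) carrier]
  [tower : IsScalarTower k (H k p) carrier]
  [finite : Module.Finite k carrier]
  deg : ℤ → Submodule k carrier
  isInternal : DirectSum.IsInternal deg
  smul_mem : ∀ i j : ℤ, ∀ h ∈ hDeg k p i, ∀ m ∈ deg j, h • m ∈ deg (i + j)

namespace GMod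

variable {k : Type u} [Field k] {p : ℕ}

instance : CoeSort (GMod k p) (Type u) := ⟨carrier⟩

attribute [instance] addCommGroup moduleBase moduleH tower finite

theorem smul_mem_of_xH {V : Type u} [AddCommGroup V] [Module k V] [Module (H k p) V]
    [IsScalarTower k (H k p) V] (A : ℤ → Submodule k V)
    (hA : ∀ j, ∀ v ∈ A j, xH k p • v ∈ A (1 + j)) :
    ∀ i j : ℤ, ∀ h ∈ hDeg k p i, ∀ m ∈ A j, h • m ∈ A (i + j) := by
  intro i j h hh m hm
  induction hh using Submodule.span_induction with
  | mem h hh =>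
    obtain ⟨n, rfl, rfl⟩ := hh
    induction n with
    | zero => simpa using hm
    | succ n ih =>
      rw [pow_succ', mul_smul, Nat.cast_succ, add_comm (n : ℤ), add_assoc]
      exact hA _ _ ih
  | zero => simp
  | add a b _ _ ha hb => rw [add_smul]; exact add_mem ha hb
  | smul c a _ ha => rw [smul_assoc]; exact Submodule.smul_mem _ _ ha

theorem xH_smul_mem (M : GMod k p) {j : ℤ} {m : M} (hm : m ∈ M.deg j) :
    xH k p • m ∈ M.deg (1 + j) :=
  M.smul_mem 1 j _ (by simpa using xH_pow_mem k p 1) m hm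

/-- Morphisms of graded modules: `H`-linear maps preserving degrees. -/
@[ext]
structure Hom (M N : GMod k p) where
  toLin : M →ₗ[H k p] N
  map_deg : ∀ i, ∀ m ∈ M.deg i, toLin m ∈ N.deg i

instance : Category (GMod k p) where
  Hom := Hom
  id M := ⟨LinearMap.id, fun _ _ h => h⟩
  comp f g := ⟨g.toLin ∘ₗ f.toLin, fun i m h => g.map_deg i _ (f.map_deg i m h)⟩

@[ext]
theorem hom_ext {M N : GMod k p} {f g : M ⟶ N} (h : f.toLin = g.toLin) : f = g := Hom.ext h

@[simp] theorem id_toLin (M : GMod k p) : Hom.toLin (𝟙 M) = LinearMap.id := rfl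

@[simp] theorem comp_toLin {M N L : GMod k p} (f : M ⟶ N) (g : N ⟶ L) :
    (f ≫ g).toLin = g.toLin ∘ₗ f.toLin := rfl

section Preadditive

variable (M N : GMod k p)

instance : Zero (M ⟶ N) := ⟨⟨0, fun i _ _ => (N.deg i).zero_mem⟩⟩
instance : Add (M ⟶ N) :=
  ⟨fun f g => ⟨f.toLin + g.toLin, fun i m h => add_mem (f.map_deg i m h) (g.map_deg i m h)⟩⟩
instance : Neg (M ⟶ N) := ⟨fun f => ⟨-f.toLin, fun i m h => neg_mem (f.map_deg i m h)⟩⟩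
instance : Sub (M ⟶ N) :=
  ⟨fun f g => ⟨f.toLin - g.toLin, fun i m h => sub_mem (f.map_deg i m h) (g.map_deg i m h)⟩⟩
instance : SMul ℕ (M ⟶ N) :=
  ⟨fun n f => ⟨n • f.toLin, fun i m h => nsmul_mem (f.map_deg i m h) n⟩⟩
instance : SMul ℤ (M ⟶ N) :=
  ⟨fun n f => ⟨n • f.toLin, fun i m h => zsmul_mem (f.map_deg i m h) n⟩⟩

instance : AddCommGroup (M ⟶ N) :=
  Function.Injective.addCommGroup (fun f : M ⟶ N => f.toLin) (fun _ _ h => hom_ext h) rfl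
    (fun _ _ => rfl) (fun _ => rfl) (fun _ _ => rfl) (fun _ _ => rfl) (fun _ _ => rfl)

instance : Preadditive (GMod k p) where
  add_comp _ _ _ _ _ _ := hom_ext (LinearMap.comp_add _ _ _)
  comp_add _ _ _ _ _ _ := hom_ext (LinearMap.add_comp _ _ _)

end Preadditive

/-- The grading shift `M{n}`, moving every degree up by `n`. -/
def shift (M : GMod k p) (n : ℤ) : GMod k p where
  carrier := M
  deg i := M.deg (i - n)
  isInternal := by
    obtain ⟨d, hd, -⟩ := exists_coaction M.isInternal
    refine isInternal_of_coaction _ ?_ ((Finsupp.lmapDomain _ k (fun i => i + n)) ∘ₗ d) ?_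
    · rw [← M.isInternal.submodule_iSup_eq_top]
      exact (Equiv.subRight n).iSup_congr fun _ => rfl
    · intro i v hv
      simp [hd _ v hv]
  smul_mem i j h hh m hm := by
    have := M.smul_mem i (j - n) h hh m hm
    rwa [← add_sub_assoc] at this

/-- The total grading on `M ⊗ N`. -/
def diagDeg (M N : GMod k p) (n : ℤ) : Submodule k (DiagTensor k M N) :=
  tensorDeg M.deg N.deg n

theorem isInternal_diagDeg (M N : GMod k p) : DirectSum.IsInternal (diagDeg M N) :=
  isInternal_tensorDeg M.isInternal N.isInternal

section Monoidal

variable [Fact p.Prime]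

/-- `H` as a graded module over itself. -/
def regular (k : Type u) [Field k] (p : ℕ) [Fact p.Prime] : GMod k p where
  carrier := H k p
  deg := hDeg k p
  isInternal := isInternal_hDeg k p
  smul_mem := smul_mem_of_xH _ (by
    intro j v hv
    induction hv using Submodule.span_induction with
    | mem h hh =>
      obtain ⟨n, rfl, rfl⟩ := hh
      rw [smul_eq_mul, ← pow_succ']
      exact Submodule.subset_span ⟨n + 1, by push_cast; ring, rfl⟩
    | zero => simp
    | add a b _ _ ha hb => rw [smul_add]; exact add_mem ha hb
    | smul c a _ ha => rw [smul_comm]; exact Submodule.smul_mem _ _ ha)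

theorem ker_modSocle (k : Type u) [Field k] (p : ℕ) [Fact p.Prime] :
    LinearMap.ker ((Submodule.span (H k p) {integralH k p}).mkQ.restrictScalars k) =
      Submodule.span k {integralH k p} := by
  ext x
  rw [LinearMap.mem_ker, LinearMap.restrictScalars_apply, Submodule.mkQ_apply,
    Submodule.Quotient.mk_eq_zero]
  constructor
  · intro hx
    obtain ⟨h, rfl⟩ := Submodule.mem_span_singleton.1 hx
    have hh : h ∈ Submodule.span k (Set.range fun n : ℕ => xH k p ^ n) :=
      span_xH_pow k p ▸ Submodule.mem_top
    induction hh using Submodule.span_induction with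
    | mem h hh =>
      obtain ⟨n, rfl⟩ := hh
      cases n with
      | zero => simp
      | succ n => simp [pow_succ, mul_assoc, xH_mul_integralH]
    | zero => simp
    | add a b _ _ ha hb =>
      rw [add_smul]
      exact add_mem (ha (Submodule.smul_mem _ _ (Submodule.mem_span_singleton_self _)))
        (hb (Submodule.smul_mem _ _ (Submodule.mem_span_singleton_self _)))
    | smul c a _ ha =>
      rw [smul_assoc]
      exact Submodule.smul_mem _ _
        (ha (Submodule.smul_mem _ _ (Submodule.mem_span_singleton_self _)))
  · intro hx
    obtain ⟨c, rfl⟩ := Submodule.mem_span_singleton.1 hx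
    exact Submodule.smul_of_tower_mem _ c (Submodule.mem_span_singleton_self _)

theorem isInternal_modSocle (k : Type u) [Field k] (p : ℕ) [Fact p.Prime] :
    DirectSum.IsInternal (fun i => (hDeg k p i).map
      ((Submodule.span (H k p) {integralH k p}).mkQ.restrictScalars k)) :=
  isInternal_map (isInternal_hDeg k p)
    ((Submodule.span (H k p) {integralH k p}).mkQ.restrictScalars k)
    (Submodule.mkQ_surjective (Submodule.span (H k p) {integralH k p}))
    {integralH k p} (ker_modSocle k p) (by
      rintro _ rfl
      exact ⟨_, xH_pow_mem k p _⟩)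

/-- The quotient `H / kΛ` of `H` by the ideal `kΛ = HΛ`. -/
def regularModSocle (k : Type u) [Field k] (p : ℕ) [Fact p.Prime] : GMod k p where
  carrier := H k p ⧸ Submodule.span (H k p) {integralH k p}
  deg i := (hDeg k p i).map
    ((Submodule.span (H k p) {integralH k p}).mkQ.restrictScalars k)
  isInternal := isInternal_modSocle k p
  smul_mem := by
    rintro i j h hh _ ⟨m, hm, rfl⟩
    exact ⟨h • m, (regular k p).smul_mem i j h hh m hm, rfl⟩

/-- The integral `Λ`, as an element of the graded module `H` shifted so that `Λ` has degree `0`. -/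
def integral (k : Type u) [Field k] (p : ℕ) [Fact p.Prime] : (regular k p).shift (1 - p) :=
  integralH k p

theorem xH_smul_integral : xH k p • integral k p = 0 := xH_mul_integralH k p

variable [CharP k p]

/-- The graded module `k`, in degree `0`, on which `H` acts through the counit. -/
def unit (k : Type u) [Field k] (p : ℕ) [Fact p.Prime] [CharP k p] : GMod k p where
  carrier := k
  moduleH := Module.compHom k (counitH k p).toRingHom
  tower :=
    letI := Module.compHom k (counitH k p).toRingHom
    ⟨fun c h m => by
      change counitH k p (c • h) * m = c * (counitH k p h * m)
      rw [map_smul, smul_eq_mul, mul_assoc]⟩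
  deg i := if i = 0 then ⊤ else ⊥
  isInternal := by
    refine isInternal_of_coaction _ ?_ (Finsupp.lsingle 0) ?_
    · exact top_unique (le_iSup_of_le 0 (by simp))
    · intro n v hv
      split_ifs at hv with h
      · rw [h]; rfl
      · rw [(Submodule.mem_bot k).1 hv]; simp
  smul_mem :=
    letI := Module.compHom k (counitH k p).toRingHom
    haveI : IsScalarTower k (H k p) k := ⟨fun c h m => by
      change counitH k p (c • h) * m = c * (counitH k p h * m)
      rw [map_smul, smul_eq_mul, mul_assoc]⟩
    smul_mem_of_xH _ (by
      intro j v _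
      have h0 : xH k p • v = 0 := by
        change counitH k p (xH k p) * v = 0
        rw [counitH, xH, AdjoinRoot.liftAlgHom_root, zero_mul]
      rw [h0]
      exact Submodule.zero_mem _)

theorem smul_mem_diagDeg (M N : GMod k p) :
    ∀ i j : ℤ, ∀ h ∈ hDeg k p i, ∀ m ∈ diagDeg M N j, h • m ∈ diagDeg M N (i + j) :=
  smul_mem_of_xH (diagDeg M N)
    (tensorAction_mem (fun _ _ => M.xH_smul_mem) (fun _ _ => N.xH_smul_mem))

/-- The tensor product over `k` of graded `H`-modules; `H` acts through the comultiplication. -/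
def tensor (M N : GMod k p) : GMod k p where
  carrier := DiagTensor k M N
  deg := diagDeg M N
  isInternal := isInternal_diagDeg M N
  smul_mem := smul_mem_diagDeg M N

/-- Pure tensors, as elements of the graded module `M ⊗ N`. -/
def tmul {M N : GMod k p} (m : M) (n : N) : tensor M N := m ⊗ₜ[k] n

theorem zero_tmul {M N : GMod k p} (n : N) : tmul (0 : M) n = 0 :=
  TensorProduct.zero_tmul (R := k) M n

theorem tmul_zero {M N : GMod k p} (m : M) : tmul m (0 : N) = 0 :=
  TensorProduct.tmul_zero (R := k) N m

theorem tmul_add {M N : GMod k p} (m : M) (a b : N) : tmul m (a + b) = tmul m a + tmul m b :=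
  TensorProduct.tmul_add (R := k) m a b

theorem xH_smul_tmul {M N : GMod k p} (m : M) (n : N) :
    xH k p • tmul m n = tmul (xH k p • m) n + tmul m (xH k p • n) :=
  tensorAction_xH M N m n

theorem tensor_induction {M N : GMod k p} {C : tensor M N → Prop} (t : tensor M N)
    (h0 : C 0) (ht : ∀ m n, C (tmul m n)) (ha : ∀ a b, C a → C b → C (a + b)) : C t :=
  TensorProduct.induction_on t h0 ht ha

/-- The tensor product of two `H`-linear maps is `H`-linear. -/
def tensorMapLin {M M' N N' : GMod k p} (f : M →ₗ[H k p] M') (g : N →ₗ[H k p] N') :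
    tensor M N →ₗ[H k p] tensor M' N' :=
  let F : tensor M N →ₗ[k] tensor M' N' :=
    TensorProduct.map (f.restrictScalars k) (g.restrictScalars k)
  linearOfX F (fun t => by
    induction t using tensor_induction with
    | h0 => rw [smul_zero, map_zero, smul_zero]
    | ht m n =>
      have hF : ∀ m n, F (tmul m n) = tmul (f m) (g n) := fun _ _ => rfl
      rw [xH_smul_tmul, map_add, hF, hF, hF, xH_smul_tmul, map_smul, map_smul]
    | ha a b ha hb => rw [smul_add, map_add, ha, hb, map_add, smul_add])

theorem tensorMapLin_tmul {M M' N N' : GMod k p} (f : M →ₗ[H k p] M') (g : N →ₗ[H k p] N')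
    (m : M) (n : N) : tensorMapLin f g (tmul m n) = tmul (f m) (g n) := rfl

theorem tensor_hom_ext {M N : GMod k p} {L : Type u} [AddCommGroup L] [Module (H k p) L]
    {f g : tensor M N →ₗ[H k p] L} (h : ∀ m n, f (tmul m n) = g (tmul m n)) : f = g := by
  ext t
  induction t using tensor_induction with
  | h0 => rw [map_zero, map_zero]
  | ht m n => exact h m n
  | ha a b ha hb => rw [map_add, map_add, ha, hb]

/-- The tensor product of two morphisms. -/
def tensorMap {M M' N N' : GMod k p} (f : M ⟶ M') (g : N ⟶ N') : tensor M N ⟶ tensor M' N' where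
  toLin := tensorMapLin f.toLin g.toLin
  map_deg n t ht := by
    induction ht using Submodule.span_induction with
    | mem t ht =>
      obtain ⟨i, j, rfl, v, hv, w, hw, rfl⟩ := ht
      exact tmul_mem_tensorDeg rfl (f.map_deg _ _ hv) (g.map_deg _ _ hw)
    | zero => exact (map_zero (tensorMapLin f.toLin g.toLin)).symm ▸ Submodule.zero_mem _
    | add a b _ _ ha hb =>
      exact (map_add (tensorMapLin f.toLin g.toLin) a b).symm ▸ add_mem ha hb
    | smul c a _ ha =>
      exact ((tensorMapLin f.toLin g.toLin).map_smul_of_tower c a).symm ▸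
        Submodule.smul_mem _ _ ha

/-- The functor `M ↦ V ⊗ M`. -/
def tensorLeft (V : GMod k p) : GMod k p ⥤ GMod k p where
  obj M := tensor V M
  map f := tensorMap (𝟙 V) f
  map_id _ := hom_ext (tensor_hom_ext fun _ _ => rfl)
  map_comp _ _ := hom_ext (tensor_hom_ext fun _ _ => rfl)

/-- `H ⊗ M` is projective: it is isomorphic to the free module on the vector space `M`. -/
theorem projective_regular_tensor (M : GMod k p) :
    Module.Projective (H k p) (tensor (regular k p) M) := by
  let one : regular k p := (1 : H k p)
  let j : M →ₗ[k] tensor (regular k p) M := TensorProduct.mk k (H k p) M 1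
  have hj : ∀ m, j m = tmul one m := fun _ => rfl
  let F : (H k p ⊗[k] M) →ₗ[H k p] tensor (regular k p) M := j.liftBaseChange (H k p)
  have hF : ∀ h m, F (h ⊗ₜ m) = h • tmul one m := fun h m => by
    rw [LinearMap.liftBaseChange_tmul, hj]
  have hpow : ∀ (n : ℕ) (m : M), tmul (xH k p ^ n • one) m ∈ LinearMap.range F := by
    intro n
    induction n with
    | zero =>
      intro m
      exact ⟨1 ⊗ₜ m, by rw [hF, pow_zero, one_smul, one_smul]⟩
    | succ n ih =>
      intro m
      have h := xH_smul_tmul (xH k p ^ n • one) m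
      rw [← mul_smul, ← pow_succ', ← sub_eq_iff_eq_add] at h
      rw [← h]
      exact sub_mem (Submodule.smul_mem _ _ (ih m)) (ih _)
  have hsurj : Function.Surjective F := by
    rw [← LinearMap.range_eq_top, eq_top_iff]
    rintro t -
    induction t using tensor_induction with
    | h0 => exact Submodule.zero_mem _
    | ha a b ha hb => exact add_mem ha hb
    | ht h m =>
      have hh : h ∈ Submodule.span k (Set.range fun n : ℕ => xH k p ^ n) :=
        span_xH_pow k p ▸ Submodule.mem_top (x := (h : H k p))
      have hlin : ∀ (c : k) (a : regular k p), tmul (c • a) m = c • tmul a m :=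
        fun c a => TensorProduct.smul_tmul' c (a : H k p) m
      have hadd : ∀ a b : regular k p, tmul (a + b) m = tmul a m + tmul b m :=
        fun a b => TensorProduct.add_tmul (R := k) (M := H k p) a b m
      induction hh using Submodule.span_induction with
      | mem h hh =>
        obtain ⟨n, rfl⟩ := hh
        have := hpow n m
        have h1 : xH k p ^ n • one = (xH k p ^ n : H k p) :=
          mul_one (xH k p ^ n)
        rwa [h1] at this
      | zero => exact (zero_tmul (M := regular k p) m).symm ▸ Submodule.zero_mem _
      | add a b _ _ ha hb =>
        exact (hadd a b).symm ▸ add_mem ha hb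
      | smul c a _ ha => exact (hlin c a).symm ▸ Submodule.smul_of_tower_mem _ c ha
  have hinj : Function.Injective F := by
    have hfin : Module.finrank k (H k p ⊗[k] M) =
      Module.finrank k (tensor (regular k p) M) := rfl
    have : Function.Injective (F.restrictScalars k) :=
      (LinearMap.injective_iff_surjective_of_finrank_eq_finrank hfin).2 hsurj
    exact this
  exact Module.Projective.of_equiv (LinearEquiv.ofBijective F ⟨hinj, hsurj⟩)

/-- The `H`-linear isomorphism `V ⊗ (M ⊗ N) ≅ M ⊗ (V ⊗ N)` permuting the factors. -/
def leftCommLin (V M N : GMod k p) :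
    tensor V (tensor M N) →ₗ[H k p] tensor M (tensor V N) :=
  let F : tensor V (tensor M N) →ₗ[k] tensor M (tensor V N) :=
    (TensorProduct.leftComm k V M N).toLinearMap
  linearOfX F (fun t => by
    have hF : ∀ v m n, F (tmul v (tmul m n)) = tmul m (tmul v n) := fun _ _ _ => rfl
    induction t using tensor_induction with
    | h0 => rw [smul_zero, map_zero, smul_zero]
    | ha a b ha hb => rw [smul_add, map_add, ha, hb, map_add, smul_add]
    | ht v s =>
      induction s using tensor_induction with
      | h0 => rw [tmul_zero, smul_zero, map_zero, smul_zero]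
      | ha a b ha hb => rw [tmul_add, smul_add, map_add, ha, hb, map_add, smul_add]
      | ht m n =>
        rw [xH_smul_tmul, xH_smul_tmul, tmul_add, hF, map_add, map_add, hF, hF, hF, xH_smul_tmul,
          xH_smul_tmul, tmul_add]
        abel)

/-- The `H`-linear map `ε ⊗ id : H ⊗ M → M`. -/
def counitLin (M : GMod k p) : tensor (regular k p) M →ₗ[H k p] M :=
  let F : tensor (regular k p) M →ₗ[k] M :=
    (TensorProduct.lid k M).toLinearMap ∘ₗ LinearMap.rTensor M (counitH k p).toLinearMap
  linearOfX F (fun t => by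
    let e : regular k p → k := fun h => counitH k p h
    have hF : ∀ (h : regular k p) m, F (tmul h m) = e h • m := fun _ _ => rfl
    have he : ∀ h : regular k p, e (xH k p • h) = 0 := fun h => by
      change counitH k p (xH k p * (show H k p from h)) = 0
      rw [map_mul, counitH, xH, AdjoinRoot.liftAlgHom_root, zero_mul]
    induction t using tensor_induction with
    | h0 => rw [smul_zero, map_zero, smul_zero]
    | ha a b ha hb => rw [smul_add, map_add, ha, hb, map_add, smul_add]
    | ht h m =>
      rw [xH_smul_tmul, map_add, hF, hF, hF, he, zero_smul, zero_add, smul_comm])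

/-- The tensor product of any module with a projective module is projective. -/
theorem projective_tensor (V P : GMod k p) (hP : Module.Projective (H k p) P) :
    Module.Projective (H k p) (tensor V P) := by
  have hs : Function.Surjective (counitLin P) := fun m =>
    ⟨tmul (M := regular k p) (1 : H k p) m, by
      change counitH k p 1 • m = m
      rw [map_one, one_smul]⟩
  obtain ⟨s, hs⟩ := Module.projective_lifting_property (counitLin P) LinearMap.id hs
  have := projective_regular_tensor (tensor V P)
  refine Module.Projective.of_split (leftCommLin V (regular k p) P ∘ₗ tensorMapLin LinearMap.id s)
    (tensorMapLin LinearMap.id (counitLin P) ∘ₗ leftCommLin (regular k p) V P)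
    (tensor_hom_ext fun v m => ?_)
  have hinv : ∀ t, leftCommLin (regular k p) V P (leftCommLin V (regular k p) P t) = t := by
    intro t
    exact (TensorProduct.leftComm k V (H k p) P).symm_apply_apply t
  rw [LinearMap.comp_apply, LinearMap.comp_apply, LinearMap.comp_apply, hinv, tensorMapLin_tmul,
    tensorMapLin_tmul, ← LinearMap.comp_apply (counitLin P), hs]
  rfl

/-- The embedding `M → H ⊗ M`, `m ↦ Λ ⊗ m`, where `H` is shifted so that `Λ` has degree `0`. -/
def integralEmb (M : GMod k p) : M ⟶ tensor ((regular k p).shift (1 - p)) M where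
  toLin := linearOfX
    (show M →ₗ[k] tensor ((regular k p).shift (1 - p)) M from
      TensorProduct.mk k (H k p) M (integralH k p)) (fun m => by
    have h : xH k p • tmul (integral k p) m = tmul (integral k p) (xH k p • m) := by
      rw [xH_smul_tmul, xH_smul_integral, zero_tmul, zero_add]
    exact h.symm)
  map_deg i m hm := by
    refine tmul_mem_tensorDeg (i := 0) (j := i) (zero_add i) ?_ hm
    change integralH k p ∈ hDeg k p (0 - (1 - p))
    have h := xH_pow_mem k p (p - 1)
    rw [Nat.cast_sub (Fact.out : p.Prime).one_le] at h
    rw [Nat.cast_one] at h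
    rwa [zero_sub, neg_sub]

/-- The projection `H → H / kΛ`, both shifted down by `p - 1`. -/
def projModSocle (k : Type u) [Field k] (p : ℕ) [Fact p.Prime] :
    (regular k p).shift (1 - p) ⟶ (regularModSocle k p).shift (1 - p) where
  toLin := (Submodule.span (H k p) {integralH k p}).mkQ
  map_deg _ m hm := ⟨m, hm, rfl⟩

/-- The functor `T M = (H / kΛ) ⊗ M` on graded modules, with `H` shifted so that `Λ` has
degree `0`. -/
def suspension (k : Type u) [Field k] (p : ℕ) [Fact p.Prime] [CharP k p] :
    GMod k p ⥤ GMod k p :=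
  tensorLeft ((regularModSocle k p).shift (1 - p))

/-- The quotient map `H ⊗ M → T M`. -/
def suspensionProj (M : GMod k p) :
    tensor ((regular k p).shift (1 - p)) M ⟶ (suspension k p).obj M :=
  tensorMap (projModSocle k p) (𝟙 M)

end Monoidal

end GMod

/-! ### The stable category -/

section Stable

variable (k : Type u) [Field k] (p : ℕ)

/-- Two morphisms are identified in the stable category when their difference factors through a
projective module. -/
def stableRel : HomRel (GMod k p) := fun M N f g =>
  ∃ P : GMod k p, Module.Projective (H k p) P ∧ ∃ (a : M ⟶ P) (b : P ⟶ N), f - g = a ≫ b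

/-- The stable category of finite-dimensional graded `H`-modules. -/
abbrev StableCat : Type (u + 1) := CategoryTheory.Quotient (stableRel k p)

/-- The quotient functor to the stable category. -/
abbrev toStable : GMod k p ⥤ StableCat k p := CategoryTheory.Quotient.functor (stableRel k p)

variable [Fact p.Prime] [CharP k p]

/-- The translation functor `T` of the stable category. -/
def stableT : StableCat k p ⥤ StableCat k p :=
  CategoryTheory.Quotient.lift (stableRel k p) (GMod.suspension k p ⋙ toStable k p) (by
    rintro M N f g ⟨P, hP, a, b, hab⟩
    refine CategoryTheory.Quotient.sound _
      ⟨(GMod.suspension k p).obj P, GMod.projective_tensor _ _ hP,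
        (GMod.suspension k p).map a, (GMod.suspension k p).map b, ?_⟩
    rw [← Functor.map_comp, ← hab]
    refine GMod.hom_ext (GMod.tensor_hom_ext fun m n => ?_)
    exact (TensorProduct.tmul_sub _ _ _).symm)

end Stable

/-! ### Triangles and the Grothendieck group -/

section Triangles

universe v w

variable {C : Type w} [Category.{v} C]

/-- Sextuples `X → Y → Z → T X` in a category with an endofunctor `T`. -/
structure Sextuple (T : C ⥤ C) where
  X : C
  Y : C
  Z : C
  u : X ⟶ Y
  v : Y ⟶ Z
  w : Z ⟶ T.obj X

/-- Isomorphism of sextuples. -/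
def Sextuple.Isom {T : C ⥤ C} (s t : Sextuple T) : Prop :=
  ∃ (a : s.X ≅ t.X) (b : s.Y ≅ t.Y) (c : s.Z ≅ t.Z),
    s.u ≫ b.hom = a.hom ≫ t.u ∧ s.v ≫ c.hom = b.hom ≫ t.v ∧ s.w ≫ T.map a.hom = c.hom ≫ t.w

/-- The Grothendieck group of a category with a translation functor and a class of distinguished
triangles: generators `[X]` for the objects `X`, and relations `[Y] = [X] + [Z]` for the
distinguished triangles `X → Y → Z → T X`. -/
abbrev GrothendieckGroup (T : C ⥤ C) (dist : Sextuple T → Prop) : Type w :=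
  FreeAbelianGroup C ⧸ AddSubgroup.closure
    {x | ∃ t : Sextuple T, dist t ∧
      x = FreeAbelianGroup.of t.Y - (FreeAbelianGroup.of t.X + FreeAbelianGroup.of t.Z)}

end Triangles

section Main

variable {k : Type u} [Field k] {p : ℕ} [Fact p.Prime] [CharP k p]

/-- Standard distinguished triangles `X → Y → C → T X`: here `C` is the cone of `f : X → Y`, the
pushout of `f` and `X → H ⊗ X`, and `h : C → T X` is the map induced by `H ⊗ X → T X`
and by `0 : Y → T X`. -/
def IsStandard (t : Sextuple (stableT k p)) : Prop :=
  ∃ (X Y C : GMod k p) (f : X ⟶ Y) (g : Y ⟶ C)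
    (f' : GMod.tensor ((GMod.regular k p).shift (1 - p)) X ⟶ C)
    (h : C ⟶ (GMod.suspension k p).obj X),
    IsPushout f (GMod.integralEmb X) g f' ∧ g ≫ h = 0 ∧ f' ≫ h = GMod.suspensionProj X ∧
    t = { X := (toStable k p).obj X
          Y := (toStable k p).obj Y
          Z := (toStable k p).obj C
          u := (toStable k p).map f
          v := (toStable k p).map g
          w := (toStable k p).map h }

/-- Distinguished triangles: the sextuples isomorphic to a standard one. -/
def IsDistinguished (t : Sextuple (stableT k p)) : Prop :=
  ∃ s : Sextuple (stableT k p), IsStandard s ∧ t.Isom s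

variable (k p) in
/-- The Grothendieck group of the stable category of finite-dimensional graded `H`-modules. -/
abbrev K0Stable : Type (u + 1) :=
  GrothendieckGroup (stableT k p) IsDistinguished

/-- The class `[M]` of a graded module in the Grothendieck group of the stable category. -/
def cls (M : GMod k p) : K0Stable k p :=
  QuotientAddGroup.mk (FreeAbelianGroup.of ((toStable k p).obj M))

end Main

/-- The ring `R_p = ℤ[q]/(1 + q + ⋯ + q ^ (p - 1))`. -/
abbrev CycloRing (p : ℕ) : Type :=
  AdjoinRoot (∑ i ∈ Finset.range p, Polynomial.X ^ i : Polynomial ℤ)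

/-- The class of `q` in `R_p`. -/
def CycloRing.q (p : ℕ) : CycloRing p := AdjoinRoot.root _

end KStable

end

/-!
The isomorphism is the graded dimension `∑ dim Mⁿ qⁿ`. A projective `P` satisfies
`ker X ⊆ X ^ j P` for `j < p`, so its graded dimension is `1 + q⁻¹ + ⋯ + q ^ (1 - p)` times that
of `ker X` and vanishes in `R_p`. Stably isomorphic modules become isomorphic after adding
projectives, and the cone of a morphism from `L` is its pushout along an injection into the
projective `I = H{1-p} ⊗ L`, so the graded dimension is defined on the Grothendieck group.

For the inverse, `I` is also injective: a `k`-linear extension of an `H`-linear map into `I` is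
made `H`-linear by means of the operator `d / dX`. Hence for a short exact sequence `L → M → N` the
cone of `L → M` is `N ⊕ I`, and `[M] = [L] + [N]`. A homogeneous vector in the top degree is killed
by `X` and spans a copy of a shift `1{n}` of the unit object, so by dévissage
`[M] = ∑ dim Mⁿ • [1{n}]`. As `[H{n}] = 0`, any `p` consecutive classes `[1{n}]` sum to zero, which
is what is needed for an additive map on `R_p` with `qⁿ ↦ [1{n}]`.
-/

noncomputable section

namespace KStable

section HomogeneousComponents

variable {ι κ R V W U : Type*} [DecidableEq ι] [DecidableEq κ] [Semiring R] [AddCommMonoid V]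
  [Module R V] [AddCommMonoid W] [Module R W] [AddCommMonoid U] [Module R U]
  {A : ι → Submodule R V} {B : κ → Submodule R W} {D : ι → Submodule R U}

theorem linearMap_ext_of_isInternal (hA : DirectSum.IsInternal A) {f g : V →ₗ[R] W}
    (h : ∀ n, ∀ v ∈ A n, f v = g v) : f = g := by
  rw [← LinearMap.eqLocus_eq_top, eq_top_iff, ← hA.submodule_iSup_eq_top]
  exact iSup_le h

/-- The linear projection of an internally graded module onto its component of degree `n`. -/
def homogeneousComponent (hA : DirectSum.IsInternal A) (n : ι) : V →ₗ[R] V :=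
  (A n).subtype ∘ₗ DirectSum.component R ι (fun i => A i) n ∘ₗ
    (LinearEquiv.ofBijective (DirectSum.coeLinearMap A) hA).symm

theorem homogeneousComponent_mem (hA : DirectSum.IsInternal A) (n : ι) (v : V) :
    homogeneousComponent hA n v ∈ A n :=
  Subtype.prop _

theorem homogeneousComponent_of_mem (hA : DirectSum.IsInternal A) {n : ι} {v : V} (hv : v ∈ A n) :
    homogeneousComponent hA n v = v :=
  congrArg Subtype.val (hA.ofBijective_coeLinearMap_of_mem hv)

theorem homogeneousComponent_of_mem_ne (hA : DirectSum.IsInternal A) {m n : ι} (hmn : m ≠ n)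
    {v : V} (hv : v ∈ A m) : homogeneousComponent hA n v = 0 :=
  congrArg Subtype.val (hA.ofBijective_coeLinearMap_of_mem_ne hmn hv)

theorem homogeneousComponent_map (hA : DirectSum.IsInternal A) (hB : DirectSum.IsInternal B)
    {τ : ι → κ} (hτ : Function.Injective τ) (f : V →ₗ[R] W)
    (hf : ∀ n, ∀ v ∈ A n, f v ∈ B (τ n)) (n : ι) (v : V) :
    homogeneousComponent hB (τ n) (f v) = f (homogeneousComponent hA n v) := by
  suffices homogeneousComponent hB (τ n) ∘ₗ f = f ∘ₗ homogeneousComponent hA n from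
    LinearMap.congr_fun this v
  refine linearMap_ext_of_isInternal hA fun m v hv => ?_
  rw [LinearMap.comp_apply, LinearMap.comp_apply]
  obtain rfl | hmn := eq_or_ne m n
  · rw [homogeneousComponent_of_mem hA hv, homogeneousComponent_of_mem hB (hf m v hv)]
  · rw [homogeneousComponent_of_mem_ne hA hmn hv,
      homogeneousComponent_of_mem_ne hB (hτ.ne hmn) (hf m v hv), map_zero]

theorem exists_mem_map_eq_of_mem_range (hA : DirectSum.IsInternal A)
    (hB : DirectSum.IsInternal B) {τ : ι → κ} (hτ : Function.Injective τ) {f : V →ₗ[R] W}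
    (hf : ∀ n, ∀ v ∈ A n, f v ∈ B (τ n)) {n : ι} {w : W} (hw : w ∈ B (τ n))
    (hr : w ∈ LinearMap.range f) : ∃ v ∈ A n, f v = w := by
  obtain ⟨v, rfl⟩ := hr
  refine ⟨homogeneousComponent hA n v, homogeneousComponent_mem hA n v, ?_⟩
  rw [← homogeneousComponent_map hA hB hτ f hf, homogeneousComponent_of_mem hB hw]

theorem map_eq_of_surjective (hA : DirectSum.IsInternal A) (hB : DirectSum.IsInternal B)
    {τ : ι → κ} (hτ : Function.Injective τ) {f : V →ₗ[R] W}
    (hf : ∀ n, ∀ v ∈ A n, f v ∈ B (τ n)) (hsurj : Function.Surjective f) (n : ι) :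
    (A n).map f = B (τ n) :=
  le_antisymm (Submodule.map_le_iff_le_comap.2 (hf n)) fun w hw =>
    exists_mem_map_eq_of_mem_range hA hB hτ hf hw (hsurj w)

/-- The part of a linear map between graded modules that preserves degrees. -/
def degreePreservingPart (hA : DirectSum.IsInternal A) (hD : DirectSum.IsInternal D)
    (f : V →ₗ[R] U) : V →ₗ[R] U :=
  DirectSum.toModule R ι U (fun n => homogeneousComponent hD n ∘ₗ f ∘ₗ (A n).subtype) ∘ₗ
    (LinearEquiv.ofBijective (DirectSum.coeLinearMap A) hA).symm

theorem degreePreservingPart_of_mem (hA : DirectSum.IsInternal A) (hD : DirectSum.IsInternal D)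
    (f : V →ₗ[R] U) {n : ι} {v : V} (hv : v ∈ A n) :
    degreePreservingPart hA hD f v = homogeneousComponent hD n (f v) := by
  have hlof : (LinearEquiv.ofBijective (DirectSum.coeLinearMap A) hA).symm v =
      DirectSum.lof R ι (fun i => A i) n ⟨v, hv⟩ := by
    rw [LinearEquiv.symm_apply_eq]
    exact (DirectSum.coeLinearMap_lof A n ⟨v, hv⟩).symm
  simp [degreePreservingPart, hlof]

theorem degreePreservingPart_mem (hA : DirectSum.IsInternal A) (hD : DirectSum.IsInternal D)
    (f : V →ₗ[R] U) (n : ι) (v : V) (hv : v ∈ A n) : degreePreservingPart hA hD f v ∈ D n := by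
  rw [degreePreservingPart_of_mem hA hD f hv]
  exact homogeneousComponent_mem hD n _

end HomogeneousComponents

section WeightedDim

variable {ι κ k V W G G' : Type*} [DivisionRing k] [AddCommGroup V] [Module k V] [AddCommGroup W]
  [Module k W] [AddCommGroup G] [AddCommGroup G']

theorem finrank_map_add_finrank_ker_inf [Module.Finite k V] (f : V →ₗ[k] W)
    (S : Submodule k V) :
    Module.finrank k (S.map f) + Module.finrank k (LinearMap.ker f ⊓ S : Submodule k V) =
      Module.finrank k S := by
  rw [← (f.domRestrict S).finrank_range_add_finrank_ker, LinearMap.range_domRestrict,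
    LinearMap.ker_domRestrict, ← Submodule.finrank_map_subtype_eq, Submodule.map_comap_subtype,
    inf_comm]

/-- The dimension of a family of subspaces, with the `n`-th one weighted by `w n`. For the
components of a graded space and `w n = q ^ n` this is the graded dimension. It is a junk value
unless all but finitely many of the subspaces vanish. -/
def weightedDim (w : ι → G) (A : ι → Submodule k V) : G :=
  ∑ᶠ n, Module.finrank k (A n) • w n

theorem finite_support_finrank_smul {A : ι → Submodule k V} (hA : {n | A n ≠ ⊥}.Finite)
    (w : ι → G) : (Function.support fun n => Module.finrank k (A n) • w n).Finite := by
  refine hA.subset (Function.support_subset_iff'.2 fun n hn => ?_)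
  rw [of_not_not hn, finrank_bot, zero_smul]

theorem weightedDim_comp_equiv (e : ι ≃ κ) (w : κ → G) (A : κ → Submodule k V) :
    weightedDim (w ∘ e) (A ∘ e) = weightedDim w A :=
  finsum_comp_equiv (f := fun n => Module.finrank k (A n) • w n) e

theorem weightedDim_zero (A : ι → Submodule k V) : weightedDim (fun _ => (0 : G)) A = 0 := by
  simp only [weightedDim, smul_zero, finsum_zero]

theorem weightedDim_add {A : ι → Submodule k V} (hA : {n | A n ≠ ⊥}.Finite) (w w' : ι → G) :
    weightedDim (fun n => w n + w' n) A = weightedDim w A + weightedDim w' A := by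
  simp only [weightedDim, smul_add]
  exact finsum_add_distrib (finite_support_finrank_smul hA w) (finite_support_finrank_smul hA w')

theorem map_weightedDim {A : ι → Submodule k V} (hA : {n | A n ≠ ⊥}.Finite) (w : ι → G)
    (φ : G →+ G') : φ (weightedDim w A) = weightedDim (fun n => φ (w n)) A := by
  simp only [weightedDim, φ.map_finsum (finite_support_finrank_smul hA w), map_nsmul]

theorem weightedDim_ker_inf_add_map [Module.Finite k V] {A : ι → Submodule k V}
    (hA : {n | A n ≠ ⊥}.Finite) (w : ι → G) (f : V →ₗ[k] W) :
    weightedDim w (fun n => LinearMap.ker f ⊓ A n) + weightedDim w (fun n => (A n).map f) =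
      weightedDim w A := by
  have hker : {n | LinearMap.ker f ⊓ A n ≠ ⊥}.Finite := hA.subset fun n hn h => hn (by simp [h])
  have hmap : {n | (A n).map f ≠ ⊥}.Finite := hA.subset fun n hn h => hn (by simp [h])
  rw [weightedDim, weightedDim, ← finsum_add_distrib (finite_support_finrank_smul hker w)
    (finite_support_finrank_smul hmap w), weightedDim]
  refine finsum_congr fun n => ?_
  rw [← add_smul, add_comm, finrank_map_add_finrank_ker_inf]

theorem weightedDim_map_of_injective (w : ι → G) (A : ι → Submodule k V) {f : V →ₗ[k] W}
    (hf : Function.Injective f) : weightedDim w (fun n => (A n).map f) = weightedDim w A :=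
  finsum_congr fun n => by rw [← ((A n).equivMapOfInjective f hf).finrank_eq]

variable [DecidableEq ι]

theorem weightedDim_eq_of_bijective {A : ι → Submodule k V} {B : ι → Submodule k W}
    (hA : DirectSum.IsInternal A) (hB : DirectSum.IsInternal B) {f : V →ₗ[k] W}
    (hf : ∀ n, ∀ v ∈ A n, f v ∈ B n) (hbij : Function.Bijective f) (w : ι → G) :
    weightedDim w A = weightedDim w B := by
  rw [← weightedDim_map_of_injective w A hbij.1,
    funext (map_eq_of_surjective hA hB Function.injective_id hf hbij.2)]
  rfl

theorem finite_ne_bot_of_isInternal [Module.Finite k V] {A : ι → Submodule k V}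
    (hA : DirectSum.IsInternal A) : {n | A n ≠ ⊥}.Finite :=
  WellFoundedGT.finite_ne_bot_of_iSupIndep hA.submodule_iSupIndep

theorem weightedDim_add_of_exact [Module.Finite k V] {U : Type*} [AddCommGroup U] [Module k U]
    {A : ι → Submodule k U} {B : ι → Submodule k V} {D : ι → Submodule k W}
    (hA : DirectSum.IsInternal A) (hB : DirectSum.IsInternal B) (hD : DirectSum.IsInternal D)
    {f : U →ₗ[k] V} {g : V →ₗ[k] W} (hf : ∀ n, ∀ v ∈ A n, f v ∈ B n)
    (hg : ∀ n, ∀ v ∈ B n, g v ∈ D n) (hinj : Function.Injective f) (hex : Function.Exact f g)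
    (hsurj : Function.Surjective g) (w : ι → G) :
    weightedDim w A + weightedDim w D = weightedDim w B := by
  have hker : ∀ n, LinearMap.ker g ⊓ B n = (A n).map f := by
    refine fun n => le_antisymm ?_ ?_
    · rintro v ⟨hv, hvB⟩
      exact exists_mem_map_eq_of_mem_range hA hB Function.injective_id hf hvB ((hex v).1 hv)
    · rintro _ ⟨v, hv, rfl⟩
      exact ⟨hex.apply_apply_eq_zero v, hf n v hv⟩
  have hmap : ∀ n, (B n).map g = D n :=
    map_eq_of_surjective hB hD Function.injective_id hg hsurj
  rw [← weightedDim_ker_inf_add_map (finite_ne_bot_of_isInternal hB) w g, funext hker,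
    funext hmap, weightedDim_map_of_injective w A hinj]

end WeightedDim

section HomogeneousBasis

variable {ι α k V G : Type*} [DecidableEq ι] [DivisionRing k] [AddCommGroup V] [Module k V]
  [AddCommGroup G] {A : ι → Submodule k V}

theorem exists_homogeneous_basis [Module.Finite k V] (hA : DirectSum.IsInternal A) :
    ∃ (m : ℕ) (b : Module.Basis (Fin m) k V) (δ : Fin m → ι), ∀ i, b i ∈ A (δ i) := by
  let b := hA.collectedBasis fun n => Module.Basis.ofVectorSpace k (A n)
  have : Finite (Σ n, Module.Basis.ofVectorSpaceIndex k (A n)) := Module.Finite.finite_basis b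
  obtain ⟨m, ⟨e⟩⟩ := Finite.exists_equiv_fin (Σ n, Module.Basis.ofVectorSpaceIndex k (A n))
  refine ⟨m, b.reindex e, fun i => (e.symm i).1, fun i => ?_⟩
  rw [Module.Basis.reindex_apply]
  exact hA.collectedBasis_mem _ _

theorem span_homogeneous_basis (hA : DirectSum.IsInternal A) (b : Module.Basis α k V)
    {δ : α → ι} (hb : ∀ i, b i ∈ A (δ i)) (n : ι) :
    Submodule.span k (Set.range fun i : {i // δ i = n} => b i) = A n := by
  refine le_antisymm ?_ fun v hv => ?_
  · rw [Submodule.span_le]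
    rintro _ ⟨⟨i, rfl⟩, rfl⟩
    exact hb i
  · suffices (⊤ : Submodule k V).map (homogeneousComponent hA n) ≤
        Submodule.span k (Set.range fun i : {i // δ i = n} => b i) from
      homogeneousComponent_of_mem hA hv ▸ this (Submodule.mem_map_of_mem Submodule.mem_top)
    rw [← b.span_eq, Submodule.map_span_le]
    rintro _ ⟨i, rfl⟩
    by_cases hi : δ i = n
    · rw [homogeneousComponent_of_mem hA (hi ▸ hb i)]
      exact Submodule.subset_span ⟨⟨i, hi⟩, rfl⟩
    · rw [homogeneousComponent_of_mem_ne hA hi (hb i)]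
      exact zero_mem _

theorem finrank_eq_card_of_homogeneous_basis [Fintype α] (hA : DirectSum.IsInternal A)
    (b : Module.Basis α k V) {δ : α → ι} (hb : ∀ i, b i ∈ A (δ i)) (n : ι) :
    Module.finrank k (A n) = Fintype.card {i // δ i = n} := by
  rw [← span_homogeneous_basis hA b hb n]
  exact finrank_span_eq_card (b.linearIndependent.comp _ Subtype.val_injective)

theorem weightedDim_of_basis [Fintype α] (hA : DirectSum.IsInternal A) (b : Module.Basis α k V)
    {δ : α → ι} (hb : ∀ i, b i ∈ A (δ i)) (w : ι → G) : weightedDim w A = ∑ i, w (δ i) := by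
  have hfiber : ∀ n, Module.finrank k (A n) • w n = ∑ i, if n = δ i then w (δ i) else 0 := by
    intro n
    rw [finrank_eq_card_of_homogeneous_basis hA b hb, Fintype.card_subtype, ← Finset.sum_const,
      Finset.sum_filter]
    refine Finset.sum_congr rfl fun i _ => ?_
    simp only [eq_comm (a := n)]
    split_ifs with h
    · rw [h]
    · rfl
  rw [weightedDim, finsum_congr hfiber, finsum_sum_comm]
  · refine Finset.sum_congr rfl fun i _ => ?_
    rw [finsum_eq_single _ (δ i) fun n hn => if_neg hn, if_pos rfl]
  · exact fun i _ => (Set.finite_singleton (δ i)).subset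
      (Function.support_subset_iff'.2 fun n hn => if_neg hn)

end HomogeneousBasis

section InternalProduct

variable {ι R V W : Type*} [DecidableEq ι] [Ring R] [AddCommGroup V] [Module R V]
  [AddCommGroup W] [Module R W] {A : ι → Submodule R V} {B : ι → Submodule R W}

theorem isInternal_prod (hA : DirectSum.IsInternal A) (hB : DirectSum.IsInternal B) :
    DirectSum.IsInternal fun n => (A n).prod (B n) := by
  refine DirectSum.isInternal_submodule_of_iSupIndep_of_iSup_eq_top (fun n => ?_) ?_
  · have hle : ⨆ (m) (_ : m ≠ n), (A m).prod (B m) ≤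
        (⨆ (m) (_ : m ≠ n), A m).prod (⨆ (m) (_ : m ≠ n), B m) :=
      iSup₂_le fun m hm => Submodule.prod_mono (le_iSup₂_of_le m hm le_rfl)
        (le_iSup₂_of_le m hm le_rfl)
    refine Disjoint.mono_right hle (disjoint_iff.2 ?_)
    rw [Submodule.prod_inf_prod, (hA.submodule_iSupIndep n).eq_bot,
      (hB.submodule_iSupIndep n).eq_bot, Submodule.prod_bot]
  · rw [eq_top_iff, ← Submodule.prod_top, ← hA.submodule_iSup_eq_top, ← hB.submodule_iSup_eq_top,
      LinearMap.prod_eq_sup_map, Submodule.map_iSup, Submodule.map_iSup]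
    simp only [Submodule.map_inl, Submodule.map_inr]
    exact sup_le (iSup_mono fun n => Submodule.prod_mono le_rfl bot_le)
      (iSup_mono fun n => Submodule.prod_mono bot_le le_rfl)

end InternalProduct

namespace GMod

variable {k : Type u} [Field k] {p : ℕ} {L M N : GMod k p}

theorem bijective_iso_hom (e : M ≅ N) : Function.Bijective e.hom.toLin :=
  Function.bijective_iff_has_inverse.2 ⟨e.inv.toLin,
    fun m => LinearMap.congr_fun (congrArg Hom.toLin e.hom_inv_id) m,
    fun n => LinearMap.congr_fun (congrArg Hom.toLin e.inv_hom_id) n⟩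

/-- The direct sum of two graded modules. -/
def prod (M N : GMod k p) : GMod k p where
  carrier := M × N
  deg n := (M.deg n).prod (N.deg n)
  isInternal := isInternal_prod M.isInternal N.isInternal
  smul_mem i j h hh _ hm := ⟨M.smul_mem i j h hh _ hm.1, N.smul_mem i j h hh _ hm.2⟩

theorem projective_prod [Module.Projective (H k p) M] [Module.Projective (H k p) N] :
    Module.Projective (H k p) (prod M N) :=
  inferInstanceAs (Module.Projective (H k p) (M × N))

/-- The inclusion of the first summand of `prod M N`. -/
def inl (M N : GMod k p) : M ⟶ prod M N :=
  ⟨LinearMap.inl (H k p) M N, fun _ _ hm => ⟨hm, Submodule.zero_mem _⟩⟩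

/-- The inclusion of the second summand of `prod M N`. -/
def inr (M N : GMod k p) : N ⟶ prod M N :=
  ⟨LinearMap.inr (H k p) M N, fun _ _ hn => ⟨Submodule.zero_mem _, hn⟩⟩

/-- The projection of `prod M N` onto its second summand. -/
def snd (M N : GMod k p) : prod M N ⟶ N :=
  ⟨LinearMap.snd (H k p) M N, fun _ _ hm => hm.2⟩

/-- The morphism into a direct sum with the given components. -/
def lift (f : L ⟶ M) (g : L ⟶ N) : L ⟶ prod M N :=
  ⟨f.toLin.prod g.toLin, fun i m hm => ⟨f.map_deg i m hm, g.map_deg i m hm⟩⟩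

/-- The morphism out of a direct sum with the given components. -/
def desc (f : M ⟶ L) (g : N ⟶ L) : prod M N ⟶ L :=
  ⟨f.toLin.coprod g.toLin, fun i _ hm => add_mem (f.map_deg i _ hm.1) (g.map_deg i _ hm.2)⟩

theorem inl_desc (f : M ⟶ L) (g : N ⟶ L) : inl M N ≫ desc f g = f :=
  hom_ext (LinearMap.coprod_inl f.toLin g.toLin)

theorem inr_desc (f : M ⟶ L) (g : N ⟶ L) : inr M N ≫ desc f g = g :=
  hom_ext (LinearMap.coprod_inr f.toLin g.toLin)

theorem desc_inl_inr_comp (f : prod M N ⟶ L) : desc (inl M N ≫ f) (inr M N ≫ f) = f :=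
  hom_ext (LinearMap.prod_ext (LinearMap.coprod_inl _ _) (LinearMap.coprod_inr _ _))

theorem lift_desc {K : GMod k p} (f : K ⟶ M) (g : K ⟶ N) (f' : M ⟶ L) (g' : N ⟶ L) :
    lift f g ≫ desc f' g' = f ≫ f' + g ≫ g' :=
  rfl

theorem ker_mkQ_range (f : M ⟶ N) :
    LinearMap.ker ((LinearMap.range f.toLin).mkQ.restrictScalars k) =
      Submodule.span k (⋃ n, ((M.deg n).map (f.toLin.restrictScalars k) : Set N)) := by
  rw [← Submodule.iSup_eq_span, ← Submodule.map_iSup, M.isInternal.submodule_iSup_eq_top]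
  ext y
  simp [LinearMap.mem_range]

/-- The cokernel of a morphism of graded modules. -/
def coker (f : M ⟶ N) : GMod k p where
  carrier := N ⧸ LinearMap.range f.toLin
  deg n := (N.deg n).map ((LinearMap.range f.toLin).mkQ.restrictScalars k)
  isInternal := by
    refine isInternal_map N.isInternal ((LinearMap.range f.toLin).mkQ.restrictScalars k)
      (Submodule.mkQ_surjective (LinearMap.range f.toLin)) _ (ker_mkQ_range f) fun y hy => ?_
    obtain ⟨n, m, hm, rfl⟩ := Set.mem_iUnion.1 hy
    exact ⟨n, f.map_deg n m hm⟩
  smul_mem := by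
    rintro i j h hh _ ⟨m, hm, rfl⟩
    exact ⟨h • m, N.smul_mem i j h hh m hm, rfl⟩

/-- The projection onto the cokernel. -/
def cokerProj (f : M ⟶ N) : N ⟶ coker f :=
  ⟨(LinearMap.range f.toLin).mkQ, fun _ m hm => ⟨m, hm, rfl⟩⟩

/-- Right exact sequences `L → M → N → 0` of graded modules. -/
structure RightExact (f : L ⟶ M) (g : M ⟶ N) : Prop where
  exact : Function.Exact f.toLin g.toLin
  surjective : Function.Surjective g.toLin

/-- Short exact sequences `0 → L → M → N → 0` of graded modules. -/
structure ShortExact (f : L ⟶ M) (g : M ⟶ N) : Prop extends RightExact f g where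
  injective : Function.Injective f.toLin

theorem rightExact_cokerProj (f : M ⟶ N) : RightExact f (cokerProj f) where
  exact := LinearMap.exact_map_mkQ_range f.toLin
  surjective := Submodule.mkQ_surjective _

theorem shortExact_prod (M N : GMod k p) : ShortExact (inl M N) (snd M N) where
  exact := Function.Exact.inl_snd
  surjective := LinearMap.snd_surjective
  injective := LinearMap.inl_injective

section Exact

variable {f : L ⟶ M} {g : M ⟶ N} {K : GMod k p}

theorem RightExact.comp_eq_zero (h : RightExact f g) : f ≫ g = 0 :=
  hom_ext h.exact.linearMap_comp_eq_zero

theorem RightExact.hom_ext (h : RightExact f g) {a b : N ⟶ K} (hab : g ≫ a = g ≫ b) : a = b :=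
  GMod.hom_ext ((LinearMap.cancel_right h.surjective).1 (congrArg Hom.toLin hab))

theorem RightExact.exists_desc (h : RightExact f g) (a : M ⟶ K) (ha : f ≫ a = 0) :
    ∃ b : N ⟶ K, g ≫ b = a := by
  have hle : LinearMap.range f.toLin ≤ LinearMap.ker a.toLin :=
    LinearMap.range_le_ker_iff.2 (congrArg Hom.toLin ha)
  let b : N →ₗ[H k p] K := (LinearMap.range f.toLin).liftQ a.toLin hle ∘ₗ
    (h.exact.linearEquivOfSurjective h.surjective).symm.toLinearMap
  have hb : ∀ m, b (g.toLin m) = a.toLin m := by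
    intro m
    simp [b, h.exact.linearEquivOfSurjective_symm_apply]
  refine ⟨⟨b, fun n y hy => ?_⟩, GMod.hom_ext (LinearMap.ext hb)⟩
  obtain ⟨m, hm, rfl⟩ := exists_mem_map_eq_of_mem_range M.isInternal N.isInternal
    Function.injective_id (f := g.toLin.restrictScalars k) g.map_deg hy (h.surjective y)
  exact (hb m).symm ▸ a.map_deg n m hm

variable {G : Type*} [AddCommGroup G]

theorem ShortExact.weightedDim_add (h : ShortExact f g) (w : ℤ → G) :
    weightedDim w L.deg + weightedDim w N.deg = weightedDim w M.deg :=
  weightedDim_add_of_exact L.isInternal M.isInternal N.isInternal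
    (f := f.toLin.restrictScalars k) (g := g.toLin.restrictScalars k) f.map_deg g.map_deg
    h.injective h.exact h.surjective w

theorem weightedDim_prod (M N : GMod k p) (w : ℤ → G) :
    weightedDim w (prod M N).deg = weightedDim w M.deg + weightedDim w N.deg :=
  ((shortExact_prod M N).weightedDim_add w).symm

theorem weightedDim_of_iso (e : M ≅ N) (w : ℤ → G) :
    weightedDim w M.deg = weightedDim w N.deg :=
  weightedDim_eq_of_bijective M.isInternal N.isInternal (f := e.hom.toLin.restrictScalars k)
    e.hom.map_deg (bijective_iso_hom e) w

end Exact

end GMod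

section ProjectiveModules

theorem exists_smul_eq_of_projective {R P : Type*} [CommRing R] [AddCommGroup P] [Module R P]
    [Module.Projective R P] {a b : R} (hab : ∀ r, a * r = 0 → b ∣ r) {m : P} (hm : a • m = 0) :
    ∃ n : P, b • n = m := by
  obtain ⟨s, hs⟩ := Module.projective_def'.1 ‹Module.Projective R P›
  have hdvd : ∀ x, b ∣ s m x := by
    refine fun x => hab _ ?_
    rw [← smul_eq_mul, ← Finsupp.smul_apply, ← map_smul, hm, map_zero, Finsupp.zero_apply]
  choose c hc using hdvd
  have hsm : Finsupp.linearCombination R id (s m) = m := LinearMap.congr_fun hs m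
  refine ⟨∑ x ∈ (s m).support, c x • x, ?_⟩
  conv_rhs => rw [← hsm, Finsupp.linearCombination_apply, Finsupp.sum]
  rw [Finset.smul_sum]
  exact Finset.sum_congr rfl fun x _ => by rw [hc, mul_smul, id]

variable {k : Type u} [Field k] {p : ℕ}

theorem xH_pow_dvd_of_xH_mul_eq_zero {j : ℕ} (hj : j < p) {h : H k p} (hh : xH k p * h = 0) :
    xH k p ^ j ∣ h := by
  induction h using AdjoinRoot.induction_on with
  | ih f =>
    obtain ⟨m, rfl⟩ := Nat.exists_eq_add_of_lt hj
    rw [xH, ← AdjoinRoot.mk_X, ← map_mul, AdjoinRoot.mk_eq_zero] at hh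
    have hdvd : (Polynomial.X : Polynomial k) ^ (j + m) ∣ f :=
      (mul_dvd_mul_iff_left Polynomial.X_ne_zero).1 (pow_succ' (Polynomial.X : Polynomial k) _ ▸ hh)
    rw [xH, ← AdjoinRoot.mk_X, ← map_pow]
    exact map_dvd _ ((pow_dvd_pow _ le_self_add).trans hdvd)

end ProjectiveModules

section ProjectiveDimension

variable {k : Type u} [Field k] {p : ℕ} {G : Type*} [AddCommGroup G]

/-- Weights on the degrees that sum to zero over any `p` consecutive degrees; these are the
weights for which weighted dimensions vanish on projective modules. -/
def IsBalanced (p : ℕ) (w : ℤ → G) : Prop :=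
  ∀ i, ∑ j ∈ Finset.range p, w (i + j) = 0

theorem IsBalanced.sum_sub_eq_zero {w : ℤ → G} (hw : IsBalanced p w) (i : ℤ) :
    ∑ j ∈ Finset.range p, w (i - j) = 0 := by
  rw [← Finset.sum_range_reflect, ← hw (i - (p - 1))]
  refine Finset.sum_congr rfl fun j hj => congrArg w ?_
  have := Finset.mem_range.1 hj
  omega

namespace GMod

variable (M : GMod k p)

/-- Multiplication by `X ^ j` on a graded module. -/
def xPow (j : ℕ) : M →ₗ[k] M := Algebra.lsmul k k M (xH k p ^ j)

theorem xPow_mem (j : ℕ) {i : ℤ} {m : M} (hm : m ∈ M.deg i) : M.xPow j m ∈ M.deg (j + i) :=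
  M.smul_mem _ _ _ (xH_pow_mem k p j) m hm

theorem xPow_xPow (i j : ℕ) (m : M) : M.xPow i (M.xPow j m) = M.xPow (i + j) m := by
  simp only [xPow, Algebra.lsmul_coe, smul_smul, pow_add]

theorem exists_xPow_eq [Module.Projective (H k p) M] {j : ℕ} (hj : j < p) {m : M}
    (hm : M.xPow 1 m = 0) : ∃ n, M.xPow j n = m := by
  refine exists_smul_eq_of_projective (a := xH k p) (fun h hh => ?_) ?_
  · exact xH_pow_dvd_of_xH_mul_eq_zero hj hh
  · simpa [xPow] using hm

theorem map_xPow_ker_inf_deg [Module.Projective (H k p) M] {j : ℕ} (hj : j < p) (i : ℤ) :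
    (LinearMap.ker (M.xPow (j + 1)) ⊓ M.deg i).map (M.xPow j) =
      LinearMap.ker (M.xPow 1) ⊓ M.deg (j + i) := by
  refine le_antisymm ?_ ?_
  · rintro _ ⟨m, ⟨hm, hmi⟩, rfl⟩
    refine ⟨?_, M.xPow_mem j hmi⟩
    rwa [SetLike.mem_coe, LinearMap.mem_ker, xPow_xPow, add_comm]
  · rintro m ⟨hm, hmi⟩
    obtain ⟨n, hn, rfl⟩ := exists_mem_map_eq_of_mem_range M.isInternal M.isInternal
      (add_right_injective (j : ℤ)) (fun _ _ => M.xPow_mem j) hmi (M.exists_xPow_eq hj hm)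
    refine ⟨n, ⟨?_, hn⟩, rfl⟩
    rwa [SetLike.mem_coe, LinearMap.mem_ker, add_comm, ← xPow_xPow]

theorem finite_inf_deg_ne_bot (S : Submodule k M) : {i | S ⊓ M.deg i ≠ ⊥}.Finite :=
  (finite_ne_bot_of_isInternal M.isInternal).subset fun i hi h => hi (by rw [h, inf_bot_eq])

theorem weightedDim_ker_xPow [Module.Projective (H k p) M] (w : ℤ → G) {j : ℕ} (hj : j ≤ p) :
    weightedDim w (fun i => LinearMap.ker (M.xPow j) ⊓ M.deg i) =
      weightedDim (fun i => ∑ l ∈ Finset.range j, w (i - l))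
        (fun i => LinearMap.ker (M.xPow 1) ⊓ M.deg i) := by
  have hzero : LinearMap.ker (M.xPow 0) = ⊥ := by
    refine LinearMap.ker_eq_bot.2 fun a b hab => ?_
    simpa [xPow] using hab
  induction j with
  | zero =>
    simp only [hzero, bot_inf_eq, Finset.range_zero, Finset.sum_empty, weightedDim_zero]
    simp [weightedDim]
  | succ j ih =>
    have hker : ∀ i, LinearMap.ker (M.xPow j) ⊓ (LinearMap.ker (M.xPow (j + 1)) ⊓ M.deg i) =
        LinearMap.ker (M.xPow j) ⊓ M.deg i := by
      refine fun i => (inf_assoc _ _ _).symm.trans (congrArg (· ⊓ _) (inf_eq_left.2 fun m hm => ?_))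
      rw [LinearMap.mem_ker, add_comm, ← xPow_xPow, LinearMap.mem_ker.1 hm, map_zero]
    have hshift : weightedDim w (fun i => LinearMap.ker (M.xPow 1) ⊓ M.deg (j + i)) =
        weightedDim (fun i => w (i - j)) (fun i => LinearMap.ker (M.xPow 1) ⊓ M.deg i) := by
      rw [← weightedDim_comp_equiv (Equiv.addLeft (j : ℤ)) (fun i => w (i - j))]
      simp [Function.comp_def]
    rw [← weightedDim_ker_inf_add_map (M.finite_inf_deg_ne_bot _) w (M.xPow j), funext hker,
      funext (M.map_xPow_ker_inf_deg hj), ih (Nat.le_of_succ_le hj), hshift,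
      ← weightedDim_add (M.finite_inf_deg_ne_bot _)]
    simp only [Finset.sum_range_succ]

theorem weightedDim_of_projective [Module.Projective (H k p) M] {w : ℤ → G}
    (hw : IsBalanced p w) : weightedDim w M.deg = 0 := by
  have htop : LinearMap.ker (M.xPow p) = ⊤ := by
    refine LinearMap.ker_eq_top.2 (LinearMap.ext fun m => ?_)
    simp [xPow, xH_pow]
  have h := M.weightedDim_ker_xPow w le_rfl
  simpa only [htop, top_inf_eq, hw.sum_sub_eq_zero, weightedDim_zero] using h

end GMod

end ProjectiveDimension

section WeylAlgebra

variable {A : Type*} [Ring A] {c d : A}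

theorem mul_pow_eq_pow_mul_sub (h : c * d = d * c - 1) (n : ℕ) :
    c * d ^ (n + 1) = d ^ (n + 1) * c - (n + 1) • d ^ n := by
  induction n with
  | zero => simpa using h
  | succ n ih =>
    rw [pow_succ, ← mul_assoc, ih, sub_mul, mul_assoc, h, smul_mul_assoc, ← pow_succ,
      succ_nsmul _ (n + 1), mul_sub, mul_one]
    noncomm_ring

theorem mul_sum_inv_factorial_smul {k : Type*} [Field k] [Algebra k A] (h : c * d = d * c - 1)
    {n : ℕ} (hn : (n.factorial : k) ≠ 0) :
    c * ∑ j ∈ Finset.range (n + 1), (j.factorial : k)⁻¹ • (d ^ j * c ^ j) =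
      (n.factorial : k)⁻¹ • (d ^ n * c ^ (n + 1)) := by
  induction n with
  | zero => simp
  | succ n ih =>
    rw [Nat.factorial_succ, Nat.cast_mul] at hn
    have hcancel : ((n + 1).factorial : k)⁻¹ • (n + 1) • (d ^ n * c ^ (n + 1)) =
        (n.factorial : k)⁻¹ • (d ^ n * c ^ (n + 1)) := by
      rw [← Nat.cast_smul_eq_nsmul k, smul_smul, Nat.factorial_succ, Nat.cast_mul, mul_inv_rev,
        inv_mul_cancel_right₀ (left_ne_zero_of_mul hn)]
    rw [Finset.sum_range_succ, mul_add, ih (right_ne_zero_of_mul hn), mul_smul_comm, ← mul_assoc,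
      mul_pow_eq_pow_mul_sub h, sub_mul, smul_sub, smul_mul_assoc, hcancel, mul_assoc, ← pow_succ',
      add_sub_cancel]

end WeylAlgebra

section SelfInjectivity

variable {k : Type u} [Field k] {p : ℕ} {V W U : Type u}
  [AddCommGroup V] [Module k V] [Module (H k p) V] [IsScalarTower k (H k p) V]
  [AddCommGroup W] [Module k W] [Module (H k p) W] [IsScalarTower k (H k p) W]
  [AddCommGroup U] [Module k U] [Module (H k p) U] [IsScalarTower k (H k p) U]

/-- `d X - X d = 1`, as for the operator `d / dX` on `H`. A module with such an operator is
injective. -/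
def IsXDerivative (p : ℕ) [Module (H k p) V] (d : V →ₗ[k] V) : Prop :=
  ∀ v, d (xH k p • v) = xH k p • d v + v

theorem exists_isXDerivative_H (k : Type u) [Field k] (p : ℕ) [CharP k p] :
    ∃ d : H k p →ₗ[k] H k p, IsXDerivative p d := by
  let π : Polynomial k →ₐ[k] H k p := AdjoinRoot.mkₐ (Polynomial.X ^ p)
  have hker : ∀ f, π f = 0 → π (Polynomial.derivative' f) = 0 := by
    intro f hf
    obtain ⟨g, rfl⟩ := AdjoinRoot.mk_eq_zero.1 hf
    refine AdjoinRoot.mk_eq_zero.2 ⟨Polynomial.derivative g, ?_⟩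
    simp [Polynomial.derivative']
  let d := Derivation.liftOfSurjective (f := π) AdjoinRoot.mk_surjective hker
  have hX : d (xH k p) = 1 := by
    have h := Derivation.liftOfSurjective_apply (f := π) AdjoinRoot.mk_surjective hker Polynomial.X
    rw [AdjoinRoot.coe_mkₐ, AdjoinRoot.mk_X] at h
    exact h.trans ((congrArg π Polynomial.derivative_X).trans (map_one π))
  refine ⟨d, fun h => ?_⟩
  simp [hX]

theorem llcomp_pow (a : Module.End k W) (n : ℕ) :
    (LinearMap.llcomp k V W W a : Module.End k (V →ₗ[k] W)) ^ n =
      LinearMap.llcomp k V W W (a ^ n) := by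
  induction n with
  | zero => rfl
  | succ n ih => rw [pow_succ', ih, pow_succ']; rfl

theorem lcomp_pow (a : Module.End k V) (n : ℕ) :
    (LinearMap.lcomp k W a : Module.End k (V →ₗ[k] W)) ^ n = LinearMap.lcomp k W (a ^ n) := by
  induction n with
  | zero => rfl
  | succ n ih => rw [pow_succ', ih, pow_succ]; rfl

/-- The operator `f ↦ X f - f X` on `k`-linear maps between `H`-modules. -/
def commX (k : Type u) [Field k] (p : ℕ) (V W : Type u) [AddCommGroup V] [Module k V]
    [Module (H k p) V] [IsScalarTower k (H k p) V] [AddCommGroup W] [Module k W]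
    [Module (H k p) W] [IsScalarTower k (H k p) W] : Module.End k (V →ₗ[k] W) :=
  LinearMap.llcomp k V W W (Algebra.lsmul k k W (xH k p)) -
    LinearMap.lcomp k W (Algebra.lsmul k k V (xH k p))

theorem commX_apply (f : V →ₗ[k] W) (v : V) :
    commX k p V W f v = xH k p • f v - f (xH k p • v) :=
  rfl

theorem commX_pow_eq_zero [Fact p.Prime] [CharP k p] : commX k p V W ^ p = 0 := by
  cases subsingleton_or_nontrivial (Module.End k (V →ₗ[k] W))
  · exact Subsingleton.elim _ _
  have := charP_of_injective_algebraMap (algebraMap k (Module.End k (V →ₗ[k] W))).injective p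
  have hcomm : Commute (LinearMap.llcomp k V W W (Algebra.lsmul k k W (xH k p)))
      (LinearMap.lcomp k W (Algebra.lsmul k k V (xH k p))) := rfl
  rw [commX, sub_pow_char_of_commute p hcomm, llcomp_pow, lcomp_pow, ← map_pow, ← map_pow, xH_pow,
    map_zero, map_zero, map_zero, zero_sub, neg_eq_zero]
  exact LinearMap.ext fun f => LinearMap.comp_zero f

theorem IsXDerivative.commX_mul_llcomp {d : W →ₗ[k] W} (hd : IsXDerivative p d) :
    commX k p V W * LinearMap.llcomp k V W W d =
      LinearMap.llcomp k V W W d * commX k p V W - 1 := by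
  ext f v
  simp only [Module.End.mul_apply, LinearMap.sub_apply, Module.End.one_apply, commX_apply,
    LinearMap.llcomp_apply, map_sub, hd _]
  abel

theorem commX_pow_succ_comp_eq_zero {N : Type*} [AddCommGroup N] [Module (H k p) N]
    {i : N →ₗ[H k p] W} {s : W →ₗ[k] U}
    (hs : ∀ v, s (i (xH k p • v)) = xH k p • s (i v)) (j : ℕ) (v : N) :
    (commX k p W U ^ (j + 1)) s (i v) = 0 := by
  induction j generalizing v with
  | zero => rw [zero_add, pow_one, commX_apply, ← map_smul i, hs, sub_self]
  | succ j ih =>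
    rw [pow_succ', Module.End.mul_apply, commX_apply, ← map_smul i, ih, ih, smul_zero, sub_zero]

-- The operator `∑ dʲ cʲ / j!`, with `c` the commutator with `X`, projects onto the kernel of `c`,
-- that is, onto the `H`-linear maps.
theorem IsXDerivative.exists_extension [Fact p.Prime] [CharP k p] {d : U →ₗ[k] U}
    (hd : IsXDerivative p d) {i : V →ₗ[H k p] W} (hi : Function.Injective i)
    (f : V →ₗ[H k p] U) : ∃ e : W →ₗ[H k p] U, e ∘ₗ i = f := by
  obtain ⟨r, hr⟩ := (i.restrictScalars k).exists_leftInverse_of_injective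
    (LinearMap.ker_eq_bot.2 hi)
  let s : W →ₗ[k] U := f.restrictScalars k ∘ₗ r
  have hsi : ∀ v, s (i v) = f v := fun v => congrArg f (LinearMap.congr_fun hr v)
  have hs : ∀ v, s (i (xH k p • v)) = xH k p • s (i v) := fun v => by rw [hsi, hsi, map_smul]
  let c := commX k p W U
  let D : Module.End k (W →ₗ[k] U) := LinearMap.llcomp k W U U d
  obtain ⟨n, hn⟩ := Nat.exists_eq_add_one.2 (Fact.out : p.Prime).pos
  have hfact : (n.factorial : k) ≠ 0 := by
    rw [Ne, CharP.cast_eq_zero_iff k p, (Fact.out : p.Prime).dvd_factorial]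
    omega
  let e := (∑ j ∈ Finset.range (n + 1), (j.factorial : k)⁻¹ • (D ^ j * c ^ j)) s
  have hce : c e = 0 := by
    rw [← Module.End.mul_apply, mul_sum_inv_factorial_smul hd.commX_mul_llcomp hfact, ← hn,
      commX_pow_eq_zero, mul_zero, smul_zero, LinearMap.zero_apply]
  have hei : ∀ v, e (i v) = f v := by
    intro v
    have hterm : ∀ j, (D ^ (j + 1)) ((c ^ (j + 1)) s) (i v) = 0 := by
      intro j
      rw [llcomp_pow, LinearMap.llcomp_apply, commX_pow_succ_comp_eq_zero hs, map_zero]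
    simp [e, Finset.sum_range_succ', hterm, hsi]
  refine ⟨linearOfX e fun w => ?_, LinearMap.ext hei⟩
  exact (sub_eq_zero.1 (LinearMap.congr_fun hce w)).symm

end SelfInjectivity

namespace GMod

variable {k : Type u} [Field k] {p : ℕ} {A B I : GMod k p}

theorem degreePreservingPart_smul (e : B →ₗ[H k p] I) (b : B) :
    degreePreservingPart B.isInternal I.isInternal (e.restrictScalars k) (xH k p • b) =
      xH k p • degreePreservingPart B.isInternal I.isInternal (e.restrictScalars k) b := by
  let e' := degreePreservingPart B.isInternal I.isInternal (e.restrictScalars k)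
  suffices e' ∘ₗ B.xPow 1 = I.xPow 1 ∘ₗ e' by simpa [xPow] using LinearMap.congr_fun this b
  refine linearMap_ext_of_isInternal B.isInternal fun n b hb => ?_
  have hcomm : I.xPow 1 (e b) = e (B.xPow 1 b) := (map_smul e _ b).symm
  have hX := homogeneousComponent_map I.isInternal I.isInternal (add_right_injective (1 : ℤ))
    (I.xPow 1) (fun _ _ => I.xPow_mem 1) n (e b)
  rw [LinearMap.comp_apply, LinearMap.comp_apply,
    degreePreservingPart_of_mem _ _ _ (B.xPow_mem 1 hb), degreePreservingPart_of_mem _ _ _ hb]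
  exact hcomm ▸ hX

theorem exists_comp_eq_of_linearMap {i : A ⟶ B} {f : A ⟶ I} {e : B →ₗ[H k p] I}
    (he : e ∘ₗ i.toLin = f.toLin) : ∃ e' : B ⟶ I, i ≫ e' = f := by
  refine ⟨⟨linearOfX _ (degreePreservingPart_smul e), degreePreservingPart_mem _ _ _⟩, ?_⟩
  suffices degreePreservingPart B.isInternal I.isInternal (e.restrictScalars k) ∘ₗ
      i.toLin.restrictScalars k = f.toLin.restrictScalars k from
    hom_ext (LinearMap.ext fun a => LinearMap.congr_fun this a)
  refine linearMap_ext_of_isInternal A.isInternal fun n a ha => ?_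
  have hea : e (i.toLin a) = f.toLin a := LinearMap.congr_fun he a
  exact (degreePreservingPart_of_mem _ _ _ (i.map_deg n a ha)).trans
    ((congrArg _ hea).trans (homogeneousComponent_of_mem _ (f.map_deg n a ha)))

theorem exists_isXDerivative_tensor [Fact p.Prime] [CharP k p] {M : GMod k p}
    (hM : ∃ d : M →ₗ[k] M, IsXDerivative p d) (N : GMod k p) :
    ∃ D : tensor M N →ₗ[k] tensor M N, IsXDerivative p D := by
  obtain ⟨d, hd⟩ := hM
  let D : tensor M N →ₗ[k] tensor M N := LinearMap.rTensor N d
  refine ⟨D, fun t => ?_⟩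
  induction t using tensor_induction with
  | h0 => rw [smul_zero, map_zero, smul_zero, add_zero]
  | ha a b ha hb => rw [smul_add, map_add, ha, hb, map_add, smul_add]; abel
  | ht m n =>
    have hD : ∀ m n, D (tmul m n) = tmul (d m) n := fun _ _ => rfl
    have hadd : tmul (xH k p • d m + m) n = tmul (xH k p • d m) n + tmul m n :=
      TensorProduct.add_tmul (R := k) _ _ _
    rw [xH_smul_tmul, map_add, hD, hD, hD, hd, xH_smul_tmul, hadd]
    abel

theorem exists_extension_regular_tensor [Fact p.Prime] [CharP k p] (M : GMod k p) (n : ℤ)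
    {i : A ⟶ B} (hi : Function.Injective i.toLin) (f : A ⟶ tensor ((regular k p).shift n) M) :
    ∃ e, i ≫ e = f := by
  obtain ⟨D, hD⟩ := exists_isXDerivative_tensor (M := (regular k p).shift n)
    (exists_isXDerivative_H k p) M
  obtain ⟨e, he⟩ := hD.exists_extension hi f.toLin
  exact exists_comp_eq_of_linearMap he

end GMod

namespace GMod

section Pushouts

variable {k : Type u} [Field k] {p : ℕ} {X Y Z I C : GMod k p}

theorem isPushout_of_rightExact {f : X ⟶ Y} {j : X ⟶ I} {π : prod Y I ⟶ C}
    (h : RightExact (lift f (-j)) π) : IsPushout f j (inl Y I ≫ π) (inr Y I ≫ π) := by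
  have hdesc : ∀ s : Limits.PushoutCocone f j, ∃ b, π ≫ b = desc s.inl s.inr := fun s =>
    h.exists_desc _ (by rw [lift_desc, Preadditive.neg_comp, s.condition, add_neg_cancel])
  choose b hb using hdesc
  refine ⟨⟨?_⟩, ⟨Limits.PushoutCocone.IsColimit.mk _ b (fun s => ?_) (fun s => ?_)
    (fun s m hl hr => h.hom_ext ?_)⟩⟩
  · have hzero : f ≫ inl Y I ≫ π + (-j) ≫ inr Y I ≫ π = 0 := by
      rw [← lift_desc, desc_inl_inr_comp, h.comp_eq_zero]
    rwa [Preadditive.neg_comp, add_neg_eq_zero] at hzero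
  · rw [Category.assoc, hb, inl_desc]
  · rw [Category.assoc, hb, inr_desc]
  · rw [hb, ← desc_inl_inr_comp (π ≫ m), ← Category.assoc, hl, ← Category.assoc, hr]

theorem ShortExact.isPushout {u : X ⟶ Y} {v : Y ⟶ Z} (h : ShortExact u v) {j : X ⟶ I}
    {e : Y ⟶ I} (he : u ≫ e = j) : IsPushout u j (lift v e) (inr Z I) := by
  subst he
  have hπ : RightExact (lift u (-(u ≫ e))) (desc (lift v e) (inr Z I)) := by
    refine ⟨fun a => ⟨fun ha => ?_, ?_⟩, fun z => ?_⟩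
    · have hv : v.toLin a.1 + 0 = 0 := congrArg Prod.fst ha
      have he : e.toLin a.1 + a.2 = 0 := congrArg Prod.snd ha
      obtain ⟨x, hx⟩ := (h.exact a.1).1 (by rwa [add_zero] at hv)
      refine ⟨x, Prod.ext hx ?_⟩
      exact (congrArg (-e.toLin ·) hx).trans (neg_eq_of_add_eq_zero_right he)
    · rintro ⟨x, rfl⟩
      exact Prod.ext ((add_zero _).trans (h.exact.apply_apply_eq_zero x))
        (add_neg_cancel (e.toLin (u.toLin x)))
    · obtain ⟨y, hy⟩ := h.surjective z.1
      refine ⟨(y, z.2 - e.toLin y), Prod.ext ?_ ?_⟩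
      · exact (add_zero (v.toLin y)).trans hy
      · exact add_sub_cancel (e.toLin y) z.2
  simpa only [inl_desc, inr_desc] using isPushout_of_rightExact hπ

theorem shortExact_of_injective {f : X ⟶ Y} (hf : Function.Injective f.toLin) :
    ShortExact f (cokerProj f) :=
  { rightExact_cokerProj f with injective := hf }

theorem weightedDim_add_of_isPushout {f : X ⟶ Y} {j : X ⟶ I} {g : Y ⟶ C} {i : I ⟶ C}
    (h : IsPushout f j g i) (hj : Function.Injective j.toLin) {G : Type*} [AddCommGroup G]
    (w : ℤ → G) :
    weightedDim w X.deg + weightedDim w C.deg = weightedDim w Y.deg + weightedDim w I.deg := by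
  have hinj : Function.Injective (lift f (-j)).toLin := fun a b hab =>
    hj (neg_injective (congrArg Prod.snd hab))
  rw [← weightedDim_prod Y I, ← (shortExact_of_injective hinj).weightedDim_add w,
    weightedDim_of_iso (h.isoIsPushout _ _ (isPushout_of_rightExact (rightExact_cokerProj _))) w]

end Pushouts

end GMod

section IntegralEmbedding

theorem integralH_ne_zero (k : Type u) [Field k] (p : ℕ) [Fact p.Prime] : integralH k p ≠ 0 := by
  have hlt : p - 1 < p := Nat.sub_lt (Fact.out : p.Prime).pos one_pos
  rw [integralH, xH, ← AdjoinRoot.mk_X, ← map_pow, Ne, AdjoinRoot.mk_eq_zero]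
  exact fun hdvd =>
    hlt.not_ge ((pow_dvd_pow_iff Polynomial.X_ne_zero Polynomial.not_isUnit_X).1 hdvd)

namespace GMod

variable {k : Type u} [Field k] {p : ℕ} [Fact p.Prime] [CharP k p]

theorem integralEmb_injective (M : GMod k p) : Function.Injective (integralEmb M).toLin := by
  obtain ⟨l, hl⟩ := Module.Projective.exists_dual_ne_zero k (integralH_ne_zero k p)
  let contraction : tensor ((regular k p).shift (1 - p)) M →ₗ[k] M :=
    (TensorProduct.lid k M).toLinearMap ∘ₗ LinearMap.rTensor M l
  intro a b hab
  have hsmul : l (integralH k p) • a = l (integralH k p) • b := congrArg contraction hab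
  exact smul_right_injective M hl hsmul

theorem integralEmb_comp_suspensionProj (M : GMod k p) : integralEmb M ≫ suspensionProj M = 0 := by
  have hzero : (projModSocle k p).toLin (integral k p) = 0 :=
    (Submodule.Quotient.mk_eq_zero _).2 (Submodule.mem_span_singleton_self _)
  refine hom_ext (LinearMap.ext fun m => ?_)
  change tmul ((projModSocle k p).toLin (integral k p)) m = 0
  rw [hzero, zero_tmul]

theorem weightedDim_add_of_isPushout_integralEmb {G : Type*} [AddCommGroup G] {w : ℤ → G}
    (hw : IsBalanced p w) {X Y C : GMod k p} {f : X ⟶ Y} {g : Y ⟶ C}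
    {i : tensor ((regular k p).shift (1 - p)) X ⟶ C} (h : IsPushout f (integralEmb X) g i) :
    weightedDim w X.deg + weightedDim w C.deg = weightedDim w Y.deg := by
  have : Module.Projective (H k p) (tensor ((regular k p).shift (1 - p)) X) :=
    projective_regular_tensor X
  rw [weightedDim_add_of_isPushout h (integralEmb_injective X),
    weightedDim_of_projective (tensor _ X) hw, add_zero]

end GMod

end IntegralEmbedding

section StableCategory

open GMod

variable {k : Type u} [Field k] {p : ℕ} {L M N : GMod k p}

/-- Morphisms that factor through a projective module; these are the morphisms that vanish in the
stable category. -/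
def FactorsThroughProjective (f : M ⟶ N) : Prop :=
  ∃ P : GMod k p, Module.Projective (H k p) P ∧ ∃ (a : M ⟶ P) (b : P ⟶ N), f = a ≫ b

namespace FactorsThroughProjective

variable {f g : M ⟶ N}

theorem comp_left (h : FactorsThroughProjective f) (l : L ⟶ M) :
    FactorsThroughProjective (l ≫ f) := by
  obtain ⟨P, hP, a, b, rfl⟩ := h
  exact ⟨P, hP, l ≫ a, b, (Category.assoc _ _ _).symm⟩

theorem comp_right (h : FactorsThroughProjective f) (l : N ⟶ L) :
    FactorsThroughProjective (f ≫ l) := by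
  obtain ⟨P, hP, a, b, rfl⟩ := h
  exact ⟨P, hP, a, b ≫ l, Category.assoc _ _ _⟩

theorem zero : FactorsThroughProjective (0 : M ⟶ N) := by
  have : Subsingleton (coker (𝟙 M)) :=
    Submodule.Quotient.subsingleton_iff.2 LinearMap.range_id
  exact ⟨coker (𝟙 M), inferInstance, 0, 0, Limits.zero_comp.symm⟩

theorem neg (h : FactorsThroughProjective f) : FactorsThroughProjective (-f) := by
  obtain ⟨P, hP, a, b, rfl⟩ := h
  exact ⟨P, hP, -a, b, (Preadditive.neg_comp a b).symm⟩

theorem add (hf : FactorsThroughProjective f) (hg : FactorsThroughProjective g) :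
    FactorsThroughProjective (f + g) := by
  obtain ⟨P, hP, a, b, rfl⟩ := hf
  obtain ⟨Q, hQ, c, d, rfl⟩ := hg
  exact ⟨prod P Q, projective_prod, lift a c, desc b d, (lift_desc a c b d).symm⟩

theorem projective (h : FactorsThroughProjective (𝟙 M)) : Module.Projective (H k p) M := by
  obtain ⟨P, hP, a, b, hab⟩ := h
  exact Module.Projective.of_split a.toLin b.toLin (congrArg Hom.toLin hab).symm

end FactorsThroughProjective

theorem stableRel_iff {f g : M ⟶ N} : stableRel k p f g ↔ FactorsThroughProjective (f - g) :=
  Iff.rfl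

instance : Congruence (stableRel k p) where
  comp_left f g g' h := by
    rw [stableRel_iff, ← Preadditive.comp_sub]
    exact (stableRel_iff.1 h).comp_left f
  comp_right g h := by
    rw [stableRel_iff, ← Preadditive.sub_comp]
    exact (stableRel_iff.1 h).comp_right g
  equivalence :=
    { refl := fun f => by
        rw [stableRel_iff, sub_self]
        exact FactorsThroughProjective.zero
      symm := fun h => by
        rw [stableRel_iff, ← neg_sub]
        exact (stableRel_iff.1 h).neg
      trans := fun h h' => by
        rw [stableRel_iff, ← sub_add_sub_cancel]
        exact (stableRel_iff.1 h).add (stableRel_iff.1 h') }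

theorem stableRel_add ⦃M N : GMod k p⦄ (f f' g g' : M ⟶ N) (hf : stableRel k p f f')
    (hg : stableRel k p g g') : stableRel k p (f + g) (f' + g') := by
  rw [stableRel_iff, add_sub_add_comm]
  exact (stableRel_iff.1 hf).add (stableRel_iff.1 hg)

instance : Preadditive (StableCat k p) :=
  CategoryTheory.Quotient.preadditive (stableRel k p) stableRel_add

instance : (toStable k p).Additive :=
  CategoryTheory.Quotient.functor_additive (stableRel k p) stableRel_add

theorem toStable_map_eq_zero_iff (f : M ⟶ N) :
    (toStable k p).map f = 0 ↔ FactorsThroughProjective f := by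
  rw [← (toStable k p).map_zero, CategoryTheory.Quotient.functor_map_eq_iff, stableRel_iff,
    sub_zero]

/-- In the stable category, `M` is isomorphic to its direct sum with a projective module. -/
def stableIsoProd (M P : GMod k p) [hP : Module.Projective (H k p) P] :
    (toStable k p).obj M ≅ (toStable k p).obj (prod M P) where
  hom := (toStable k p).map (inl M P)
  inv := (toStable k p).map (desc (𝟙 M) 0)
  hom_inv_id := by rw [← Functor.map_comp, inl_desc, CategoryTheory.Functor.map_id]
  inv_hom_id := by
    have hid : 𝟙 (prod M P) = desc (𝟙 M) 0 ≫ inl M P + snd M P ≫ inr M P :=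
      hom_ext (LinearMap.ext fun m => Prod.ext
        ((add_zero (m.1 + 0)).trans (add_zero m.1)).symm (zero_add m.2).symm)
    have hzero : (toStable k p).map (snd M P ≫ inr M P) = 0 :=
      (toStable_map_eq_zero_iff _).2 ⟨P, hP, _, _, rfl⟩
    rw [← CategoryTheory.Functor.map_id, hid, Functor.map_add, hzero, add_zero, Functor.map_comp]

theorem projective_coker_of_retraction {i : M ⟶ N} {r : N ⟶ M} (hir : i ≫ r = 𝟙 M)
    [Epi ((toStable k p).map i)] : Module.Projective (H k p) (coker i) := by
  have hcoker : RightExact i (cokerProj i) := rightExact_cokerProj i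
  obtain ⟨s, hs⟩ := hcoker.exists_desc (𝟙 N - r ≫ i)
    (by rw [Preadditive.comp_sub, reassoc_of% hir, Category.comp_id, sub_self])
  have hsection : s ≫ cokerProj i = 𝟙 (coker i) := hcoker.hom_ext (by
    rw [← Category.assoc, hs, Preadditive.sub_comp, Category.assoc, hcoker.comp_eq_zero,
      Limits.comp_zero, sub_zero, Category.id_comp, Category.comp_id])
  have hproj : (toStable k p).map (cokerProj i) = 0 := by
    rw [← cancel_epi ((toStable k p).map i), ← Functor.map_comp, hcoker.comp_eq_zero,
      Functor.map_zero, Limits.comp_zero]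
  apply FactorsThroughProjective.projective
  rw [← toStable_map_eq_zero_iff, ← hsection, Functor.map_comp, hproj, Limits.comp_zero]

theorem exists_retraction_of_stableIso (e : (toStable k p).obj M ≅ (toStable k p).obj N) :
    ∃ P : GMod k p, Module.Projective (H k p) P ∧ ∃ (i : M ⟶ prod N P) (r : prod N P ⟶ M),
      i ≫ r = 𝟙 M ∧ IsIso ((toStable k p).map i) := by
  obtain ⟨f, hf⟩ := (toStable k p).map_surjective e.hom
  obtain ⟨g, hg⟩ := (toStable k p).map_surjective e.inv
  obtain ⟨P, hP, a, b, hab⟩ : FactorsThroughProjective (𝟙 M - f ≫ g) := by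
    rw [← toStable_map_eq_zero_iff, Functor.map_sub, Functor.map_comp, hf, hg, e.hom_inv_id,
      CategoryTheory.Functor.map_id, sub_self]
  refine ⟨P, hP, lift f a, desc g b, by rw [lift_desc, ← hab, add_sub_cancel], ?_⟩
  have hfirst : (toStable k p).map (lift f a) ≫ (stableIsoProd N P).inv = e.hom := by
    rw [stableIsoProd, ← Functor.map_comp, lift_desc, Category.comp_id, Limits.comp_zero, add_zero,
      hf]
  exact IsIso.of_isIso_fac_right hfirst

theorem weightedDim_of_stableIso {G : Type*} [AddCommGroup G] {w : ℤ → G}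
    (hw : IsBalanced p w) (e : (toStable k p).obj M ≅ (toStable k p).obj N) :
    weightedDim w M.deg = weightedDim w N.deg := by
  obtain ⟨P, hP, i, r, hir, hi⟩ := exists_retraction_of_stableIso e
  have hcoker : Module.Projective (H k p) (coker i) := projective_coker_of_retraction hir
  have hinj : Function.Injective i.toLin :=
    Function.LeftInverse.injective fun m => LinearMap.congr_fun (congrArg Hom.toLin hir) m
  have hadd := (shortExact_of_injective hinj).weightedDim_add w
  rwa [weightedDim_prod, weightedDim_of_projective P hw, weightedDim_of_projective (coker i) hw,
    add_zero, add_zero] at hadd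

end StableCategory

section Triangulated

universe v w

variable {C : Type w} [Category.{v} C] {T : C ⥤ C}

theorem Sextuple.Isom.refl (t : Sextuple T) : t.Isom t :=
  ⟨Iso.refl _, Iso.refl _, Iso.refl _, by simp, by simp, by simp⟩

theorem Sextuple.Isom.trans {r s t : Sextuple T} (h : r.Isom s) (h' : s.Isom t) : r.Isom t := by
  obtain ⟨a, b, c, hu, hv, hw⟩ := h
  obtain ⟨a', b', c', hu', hv', hw'⟩ := h'
  refine ⟨a ≪≫ a', b ≪≫ b', c ≪≫ c', ?_, ?_, ?_⟩
  · simp only [Iso.trans_hom, Category.assoc, reassoc_of% hu, hu']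
  · simp only [Iso.trans_hom, Category.assoc, reassoc_of% hv, hv']
  · simp only [Iso.trans_hom, Functor.map_comp, Category.assoc, reassoc_of% hw, hw']

namespace GrothendieckGroup

variable {dist : Sextuple T → Prop}

variable (dist) in
/-- The class of an object in the Grothendieck group. -/
def of (X : C) : GrothendieckGroup T dist :=
  QuotientAddGroup.mk (FreeAbelianGroup.of X)

theorem of_eq_add {t : Sextuple T} (ht : dist t) : of dist t.Y = of dist t.X + of dist t.Z :=
  sub_eq_zero.1 ((QuotientAddGroup.eq_zero_iff _).2 (AddSubgroup.subset_closure ⟨t, ht, rfl⟩))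

theorem of_eq_of_iso (hdist : ∀ s t : Sextuple T, s.Isom t → dist t → dist s) {t : Sextuple T}
    (ht : dist t) {Y : C} (e : Y ≅ t.Y) : of dist Y = of dist t.Y := by
  let s : Sextuple T := { t with Y := Y, u := t.u ≫ e.inv, v := e.hom ≫ t.v }
  have hs : s.Isom t := ⟨Iso.refl _, e, Iso.refl _, by simp [s], by simp [s], by simp [s]⟩
  exact (of_eq_add (hdist s t hs ht)).trans (of_eq_add ht).symm

variable {G : Type*} [AddCommGroup G]

/-- The homomorphism from the Grothendieck group induced by a function on objects that is additive
on distinguished triangles. -/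
def lift (φ : C → G) (hφ : ∀ t, dist t → φ t.Y = φ t.X + φ t.Z) : GrothendieckGroup T dist →+ G :=
  QuotientAddGroup.lift _ (FreeAbelianGroup.lift φ) (by
    rw [AddSubgroup.closure_le]
    rintro _ ⟨t, ht, rfl⟩
    rw [SetLike.mem_coe, AddMonoidHom.mem_ker, map_sub, map_add, FreeAbelianGroup.lift_apply_of,
      FreeAbelianGroup.lift_apply_of, FreeAbelianGroup.lift_apply_of, hφ t ht, sub_self])

theorem lift_of (φ : C → G) (hφ : ∀ t, dist t → φ t.Y = φ t.X + φ t.Z) (X : C) :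
    lift φ hφ (of dist X) = φ X :=
  FreeAbelianGroup.lift_apply_of φ X

theorem addMonoidHom_ext {f g : GrothendieckGroup T dist →+ G}
    (h : ∀ X, f (of dist X) = g (of dist X)) : f = g :=
  QuotientAddGroup.addMonoidHom_ext _ (FreeAbelianGroup.lift_ext _ _ h)

end GrothendieckGroup

end Triangulated

section Relations

open GMod

variable {k : Type u} [Field k] {p : ℕ} [Fact p.Prime] [CharP k p]

theorem isDistinguished_of_isom (s t : Sextuple (stableT k p)) (hst : s.Isom t)
    (ht : IsDistinguished t) : IsDistinguished s := by
  obtain ⟨r, hr, htr⟩ := ht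
  exact ⟨r, hr, hst.trans htr⟩

theorem exists_isDistinguished_of_isPushout {X Y C : GMod k p} {f : X ⟶ Y} {g : Y ⟶ C}
    {i : tensor ((regular k p).shift (1 - p)) X ⟶ C} (h : IsPushout f (integralEmb X) g i) :
    ∃ w : (toStable k p).obj C ⟶ (stableT k p).obj ((toStable k p).obj X),
      IsDistinguished ⟨_, _, _, (toStable k p).map f, (toStable k p).map g, w⟩ := by
  have hzero : f ≫ (0 : Y ⟶ (suspension k p).obj X) = integralEmb X ≫ suspensionProj X := by
    rw [integralEmb_comp_suspensionProj, Limits.comp_zero]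
  exact ⟨_, _, ⟨X, Y, C, f, g, i, h.desc 0 (suspensionProj X) hzero, h, h.inl_desc _ _ _,
    h.inr_desc _ _ _, rfl⟩, Sextuple.Isom.refl _⟩

theorem cls_add_of_isPushout {X Y C : GMod k p} {f : X ⟶ Y} {g : Y ⟶ C}
    {i : tensor ((regular k p).shift (1 - p)) X ⟶ C} (h : IsPushout f (integralEmb X) g i) :
    cls X + cls C = cls Y := by
  obtain ⟨w, hw⟩ := exists_isDistinguished_of_isPushout h
  exact (GrothendieckGroup.of_eq_add hw).symm

theorem cls_eq_of_stableIso {M N : GMod k p} (e : (toStable k p).obj M ≅ (toStable k p).obj N) :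
    cls M = cls N := by
  obtain ⟨w, hw⟩ := exists_isDistinguished_of_isPushout
    (isPushout_of_rightExact (rightExact_cokerProj (lift (𝟙 N) (-integralEmb N))))
  exact GrothendieckGroup.of_eq_of_iso isDistinguished_of_isom hw e

theorem cls_prod_of_projective (M P : GMod k p) [Module.Projective (H k p) P] :
    cls (prod M P) = cls M :=
  (cls_eq_of_stableIso (stableIsoProd M P)).symm

theorem cls_add_of_shortExact {X Y Z : GMod k p} {u : X ⟶ Y} {v : Y ⟶ Z} (h : ShortExact u v) :
    cls X + cls Z = cls Y := by
  have : Module.Projective (H k p) (tensor ((regular k p).shift (1 - p)) X) :=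
    projective_regular_tensor X
  obtain ⟨e, he⟩ := exists_extension_regular_tensor X (1 - p) h.injective (integralEmb X)
  rw [← cls_add_of_isPushout (h.isPushout he), cls_prod_of_projective]

theorem cls_eq_zero_of_projective (P : GMod k p) [Module.Projective (H k p) P] : cls P = 0 := by
  have hadd := cls_add_of_shortExact (shortExact_prod P P)
  rwa [cls_prod_of_projective, add_eq_left] at hadd

/-- The weighted dimension for a balanced weight, as a homomorphism on the Grothendieck group. -/
def weightedDimHom {G : Type*} [AddCommGroup G] {w : ℤ → G} (hw : IsBalanced p w) :
    K0Stable k p →+ G :=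
  GrothendieckGroup.lift (fun M => weightedDim w M.as.deg) (by
    rintro t ⟨s, ⟨X, Y, C, f, g, i, h, hpo, -, -, rfl⟩, a, b, c, -⟩
    rw [weightedDim_of_stableIso hw a, weightedDim_of_stableIso hw b,
      weightedDim_of_stableIso hw c]
    exact (weightedDim_add_of_isPushout_integralEmb hw hpo).symm)

theorem weightedDimHom_cls {G : Type*} [AddCommGroup G] {w : ℤ → G} (hw : IsBalanced p w)
    (M : GMod k p) : weightedDimHom hw (cls M) = weightedDim w M.deg :=
  GrothendieckGroup.lift_of _ _ _

end Relations

section Devissage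

namespace GMod

variable {k : Type u} [Field k] {p : ℕ}

theorem exists_deg_ne_bot (M : GMod k p) [Nontrivial M] : {n | M.deg n ≠ ⊥}.Nonempty := by
  by_contra! hempty
  have hbot : ∀ n, M.deg n = ⊥ := fun n =>
    of_not_not fun hn => (Set.eq_empty_iff_forall_notMem.1 hempty n) hn
  have htop := M.isInternal.submodule_iSup_eq_top
  rw [iSup_congr hbot, iSup_bot] at htop
  exact bot_ne_top htop

theorem exists_homogeneous_xH_smul_eq_zero (M : GMod k p) [Nontrivial M] :
    ∃ n, ∃ v ∈ M.deg n, v ≠ 0 ∧ xH k p • v = 0 := by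
  obtain ⟨n, hn, hmax⟩ :=
    (finite_ne_bot_of_isInternal M.isInternal).exists_maximal M.exists_deg_ne_bot
  obtain ⟨v, hv, hv0⟩ := (Submodule.ne_bot_iff _).1 hn
  have hbot : M.deg (1 + n) = ⊥ := by
    by_contra hne
    have := hmax hne (by omega)
    omega
  exact ⟨n, v, hv, hv0, (Submodule.mem_bot k).1 (hbot ▸ M.xH_smul_mem hv)⟩

theorem ShortExact.finrank_lt {L M N : GMod k p} {f : L ⟶ M} {g : M ⟶ N} (h : ShortExact f g)
    [Nontrivial L] : Module.finrank k N < Module.finrank k M := by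
  obtain ⟨a, ha⟩ := exists_ne (0 : L)
  let f' := f.toLin.restrictScalars k
  let g' := g.toLin.restrictScalars k
  have hker : f' a ∈ LinearMap.ker g' := (h.exact _).2 ⟨a, rfl⟩
  have hpos : 0 < Module.finrank k (LinearMap.ker g') :=
    Module.finrank_pos_iff_exists_ne_zero.2
      ⟨⟨f' a, hker⟩, fun hzero =>
        ha (h.injective ((congrArg Subtype.val hzero).trans (map_zero f').symm))⟩
  have hrank := g'.finrank_range_add_finrank_ker
  rw [show LinearMap.range g' = ⊤ from LinearMap.range_eq_top.2 h.surjective,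
    finrank_top] at hrank
  omega

variable [Fact p.Prime] [CharP k p]

theorem xH_smul_unit (c : unit k p) : xH k p • c = 0 := by
  change counitH k p (xH k p) * (show k from c) = 0
  rw [counitH, xH, AdjoinRoot.liftAlgHom_root, zero_mul]

/-- The morphism from a shift of the unit object given by a homogeneous element killed by `X`. -/
def ofUnit {M : GMod k p} {n : ℤ} {v : M} (hv : v ∈ M.deg n) (hxv : xH k p • v = 0) :
    (unit k p).shift n ⟶ M where
  toLin := linearOfX (show (unit k p).shift n →ₗ[k] M from LinearMap.toSpanSingleton k M v)
    (fun c => by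
      have hc : xH k p • c = 0 := xH_smul_unit (k := k) (p := p) c
      rw [hc, map_zero]
      change (0 : M) = xH k p • (show k from c) • v
      rw [smul_comm, hxv, smul_zero])
  map_deg i c hc := by
    change (show k from c) • v ∈ M.deg i
    change c ∈ (if i - n = 0 then ⊤ else ⊥ : Submodule k k) at hc
    split_ifs at hc with hin
    · exact sub_eq_zero.1 hin ▸ Submodule.smul_mem _ _ hv
    · have hc0 : (show k from c) = 0 := (Submodule.mem_bot k).1 hc
      rw [hc0, zero_smul]
      exact Submodule.zero_mem _

theorem eq_of_additive {G : Type*} [AddCommGroup G] {φ ψ : GMod k p → G}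
    (hφ : ∀ {L M N : GMod k p} {f : L ⟶ M} {g : M ⟶ N}, ShortExact f g → φ L + φ N = φ M)
    (hψ : ∀ {L M N : GMod k p} {f : L ⟶ M} {g : M ⟶ N}, ShortExact f g → ψ L + ψ N = ψ M)
    (hunit : ∀ n, φ ((unit k p).shift n) = ψ ((unit k p).shift n)) (M : GMod k p) :
    φ M = ψ M := by
  induction hd : Module.finrank k M using Nat.strong_induction_on generalizing M with
  | _ d ih =>
    rcases subsingleton_or_nontrivial M with hM | hM
    · have hzero : ShortExact (𝟙 M) (𝟙 M) :=
        ⟨⟨fun m => ⟨fun _ => ⟨m, rfl⟩, fun _ => Subsingleton.elim _ _⟩, fun m => ⟨m, rfl⟩⟩,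
          fun _ _ h => h⟩
      rw [add_eq_left.1 (hφ hzero), add_eq_left.1 (hψ hzero)]
    · obtain ⟨n, v, hv, hv0, hxv⟩ := M.exists_homogeneous_xH_smul_eq_zero
      have hexact : ShortExact (ofUnit hv hxv) (cokerProj (ofUnit hv hxv)) :=
        shortExact_of_injective fun a b hab => smul_left_injective k hv0 hab
      have : Nontrivial ((unit k p).shift n) := inferInstanceAs (Nontrivial k)
      rw [← hφ hexact, ← hψ hexact, hunit, ih _ (hd ▸ hexact.finrank_lt) _ rfl]

end GMod

end Devissage

section WeightedDimension

namespace GMod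

variable {k : Type u} [Field k] {p : ℕ}

theorem weightedDim_shift {G : Type*} [AddCommGroup G] (M : GMod k p) (n : ℤ) (w : ℤ → G) :
    weightedDim w (M.shift n).deg = weightedDim (fun i => w (i + n)) M.deg := by
  rw [← weightedDim_comp_equiv (Equiv.addRight n)]
  exact congrArg _ (funext fun i => congrArg M.deg (add_sub_cancel_right i n))

variable [Fact p.Prime]

theorem weightedDim_regular {G : Type*} [AddCommGroup G] (w : ℤ → G) :
    weightedDim w (regular k p).deg = ∑ j ∈ Finset.range p, w j := by
  let b := (AdjoinRoot.powerBasis'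
    (Polynomial.monic_X_pow p : (Polynomial.X ^ p : Polynomial k).Monic))
  have hdim : b.dim = p := Polynomial.natDegree_X_pow p
  have hb : ∀ i : Fin b.dim, b.basis i ∈ (regular k p).deg (i : ℕ) := fun i => by
    rw [b.basis_eq_pow]
    exact xH_pow_mem k p i
  refine (weightedDim_of_basis (regular k p).isInternal b.basis hb w).trans ?_
  rw [Fin.sum_univ_eq_sum_range (fun j => w j), hdim]

variable [CharP k p]

theorem weightedDim_unit {G : Type*} [AddCommGroup G] (w : ℤ → G) :
    weightedDim w (unit k p).deg = w 0 := by
  have hb : ∀ i, Module.Basis.singleton (Fin 1) k i ∈ (unit k p).deg 0 := fun _ => by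
    change _ ∈ if (0 : ℤ) = 0 then (⊤ : Submodule k k) else ⊥
    rw [if_pos rfl]
    exact Submodule.mem_top
  refine (weightedDim_of_basis (unit k p).isInternal _ hb w).trans ?_
  rw [Fin.sum_univ_one]

theorem weightedDim_shift_unit {G : Type*} [AddCommGroup G] (n : ℤ) (w : ℤ → G) :
    weightedDim w ((unit k p).shift n).deg = w n := by
  rw [weightedDim_shift, weightedDim_unit, zero_add]

theorem weightedDim_tensor {R : Type*} [CommRing R] {w : ℤ → R} (hw : ∀ i j, w (i + j) = w i * w j)
    (M N : GMod k p) :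
    weightedDim w (tensor M N).deg = weightedDim w M.deg * weightedDim w N.deg := by
  obtain ⟨m, b, δ, hb⟩ := exists_homogeneous_basis M.isInternal
  obtain ⟨n, c, ε, hc⟩ := exists_homogeneous_basis N.isInternal
  have hbc : ∀ i, b.tensorProduct c i ∈ (tensor M N).deg (δ i.1 + ε i.2) := fun i => by
    rw [Module.Basis.tensorProduct_apply']
    exact tmul_mem_tensorDeg rfl (hb i.1) (hc i.2)
  have htensor := weightedDim_of_basis (tensor M N).isInternal (b.tensorProduct c) hbc w
  rw [weightedDim_of_basis M.isInternal b hb, weightedDim_of_basis N.isInternal c hc,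
    Finset.sum_mul_sum, ← Fintype.sum_prod_type']
  simpa only [hw] using htensor

end GMod

end WeightedDimension

section BalancedSequences

variable {G : Type*} [AddCommGroup G] {p : ℕ} {w w' : ℤ → G}

theorem IsBalanced.periodic (hw : IsBalanced p w) : Function.Periodic w (p : ℤ) := fun i => by
  have hleft : ∑ j ∈ Finset.range (p + 1), w (i + j) = w i := by
    rw [Finset.sum_range_succ', Nat.cast_zero, add_zero, add_eq_right, ← hw (i + 1)]
    refine Finset.sum_congr rfl fun j _ => congrArg w ?_
    rw [Nat.cast_add_one, add_right_comm, add_assoc]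
  have hright : ∑ j ∈ Finset.range (p + 1), w (i + j) = w (i + p) := by
    rw [Finset.sum_range_succ, hw i, zero_add]
  exact hright.symm.trans hleft

theorem IsBalanced.map {G' : Type*} [AddCommGroup G'] (hw : IsBalanced p w) (f : G →+ G') :
    IsBalanced p fun n => f (w n) := fun i => by
  rw [← map_sum, hw i, map_zero]

theorem IsBalanced.ext [NeZero p] (hw : IsBalanced p w) (hw' : IsBalanced p w')
    (h : ∀ n : ℕ, w n = w' n) (n : ℤ) : w n = w' n := by
  have hp : (1 : ℤ) ≤ p := by exact_mod_cast NeZero.one_le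
  have hnonneg : 0 ≤ n + n.natAbs * p := by
    have : (n.natAbs : ℤ) * 1 ≤ n.natAbs * p := by gcongr
    omega
  obtain ⟨m, hm⟩ := Int.eq_ofNat_of_zero_le hnonneg
  rw [← hw.periodic.nat_mul n.natAbs n, ← hw'.periodic.nat_mul n.natAbs n, hm, h]

end BalancedSequences

namespace CycloRing

variable {p : ℕ}

variable (p) in
theorem sum_q_pow : ∑ i ∈ Finset.range p, q p ^ i = 0 := by
  have h := AdjoinRoot.mk_self (f := (∑ i ∈ Finset.range p, Polynomial.X ^ i : Polynomial ℤ))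
  simp only [map_sum, map_pow, AdjoinRoot.mk_X] at h
  exact h

variable (p) in
theorem q_pow : q p ^ p = 1 := by
  have h := mul_geom_sum (q p) p
  rw [sum_q_pow, mul_zero] at h
  exact (sub_eq_zero.1 h.symm)

/-- The generator `q` as a unit, so that it has integral powers. -/
def qUnit (p : ℕ) [NeZero p] : (CycloRing p)ˣ :=
  Units.ofPowEqOne (q p) p (q_pow p) (NeZero.ne p)

theorem val_qUnit (p : ℕ) [NeZero p] : (qUnit p : CycloRing p) = q p := rfl

theorem val_qUnit_zpow_natCast (p : ℕ) [NeZero p] (n : ℕ) :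
    ((qUnit p ^ (n : ℤ) : (CycloRing p)ˣ) : CycloRing p) = q p ^ n := by
  rw [zpow_natCast, Units.val_pow_eq_pow_val, val_qUnit]

theorem isBalanced_zpow (p : ℕ) [NeZero p] :
    IsBalanced p fun n => ((qUnit p ^ n : (CycloRing p)ˣ) : CycloRing p) := fun i => by
  simp only [zpow_add, Units.val_mul, val_qUnit_zpow_natCast]
  rw [← Finset.mul_sum, sum_q_pow, mul_zero]

theorem addMonoidHom_ext {G : Type*} [AddCommGroup G] {f g : CycloRing p →+ G}
    (h : ∀ n : ℕ, f (q p ^ n) = g (q p ^ n)) : f = g := by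
  suffices f.comp (AdjoinRoot.mk _).toAddMonoidHom = g.comp (AdjoinRoot.mk _).toAddMonoidHom from
    (AddMonoidHom.cancel_right AdjoinRoot.mk_surjective).1 this
  ext n
  simpa [← Polynomial.X_pow_eq_monomial, q] using h n

variable {G : Type*} [AddCommGroup G] {w : ℤ → G}

/-- The additive map `ℤ[q] →+ G` with `q ^ n ↦ w n`. -/
def polynomialLift (w : ℤ → G) : Polynomial ℤ →+ G :=
  (Polynomial.lsum fun n => LinearMap.toSpanSingleton ℤ G (w n)).toAddMonoidHom

theorem polynomialLift_monomial (w : ℤ → G) (n : ℕ) (a : ℤ) :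
    polynomialLift w (Polynomial.monomial n a) = a • w n :=
  Polynomial.sum_monomial_index _ _ (zero_smul ℤ (w n))

theorem polynomialLift_mul (hw : IsBalanced p w) (f : Polynomial ℤ) :
    polynomialLift w ((∑ i ∈ Finset.range p, Polynomial.X ^ i) * f) = 0 := by
  induction f using Polynomial.induction_on' with
  | add f g hf hg => rw [mul_add, map_add, hf, hg, add_zero]
  | monomial n a =>
    simp only [Finset.sum_mul, map_sum, mul_comm (Polynomial.X ^ _),
      Polynomial.monomial_mul_X_pow, polynomialLift_monomial, Nat.cast_add]
    rw [← Finset.smul_sum, hw, smul_zero]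

/-- The universal property of the additive group of `R_p`: a sequence in which any `p` consecutive
terms sum to `0` extends to an additive map with `q ^ n ↦ w n`. -/
def lift (hw : IsBalanced p w) : CycloRing p →+ G :=
  AddMonoidHom.liftOfSurjective (AdjoinRoot.mk _).toAddMonoidHom AdjoinRoot.mk_surjective
    ⟨polynomialLift w, fun f hf => by
      obtain ⟨g, rfl⟩ := AdjoinRoot.mk_eq_zero.1 hf
      exact polynomialLift_mul hw g⟩

theorem lift_q_pow (hw : IsBalanced p w) (n : ℕ) : lift hw (q p ^ n) = w n := by
  have hq : q p ^ n = AdjoinRoot.mk _ (Polynomial.X ^ n) := by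
    rw [map_pow, AdjoinRoot.mk_X, q]
  rw [hq]
  refine (AddMonoidHom.liftOfRightInverse_comp_apply _ _ _ _ _).trans ?_
  change polynomialLift w _ = _
  rw [← Polynomial.monomial_one_right_eq_X_pow, polynomialLift_monomial, one_smul]

theorem lift_zpow [NeZero p] (hw : IsBalanced p w) (n : ℤ) :
    lift hw ((qUnit p ^ n : (CycloRing p)ˣ) : CycloRing p) = w n :=
  ((isBalanced_zpow p).map (lift hw)).ext hw
    (fun n => by rw [val_qUnit_zpow_natCast, lift_q_pow]) n

end CycloRing

section UnitClasses

variable (k : Type u) [Field k] (p : ℕ) [Fact p.Prime] [CharP k p]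

/-- The class of the unit object placed in degree `n`. -/
def unitCls (n : ℤ) : K0Stable k p :=
  cls ((GMod.unit k p).shift n)

variable {k p}

theorem cls_eq_weightedDim (M : GMod k p) : cls M = weightedDim (unitCls k p) M.deg := by
  refine GMod.eq_of_additive (φ := cls) (ψ := fun M => weightedDim (unitCls k p) M.deg)
    cls_add_of_shortExact (fun h => h.weightedDim_add _) (fun n => ?_) M
  rw [GMod.weightedDim_shift_unit, unitCls]

theorem cls_unit : cls (GMod.unit k p) = unitCls k p 0 := by
  rw [cls_eq_weightedDim, GMod.weightedDim_unit]

theorem cls_shift_unit_shift (n : ℤ) :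
    cls (((GMod.unit k p).shift n).shift 1) = unitCls k p (n + 1) := by
  rw [cls_eq_weightedDim, GMod.weightedDim_shift, GMod.weightedDim_shift_unit]

variable (k p) in
theorem isBalanced_unitCls : IsBalanced p (unitCls k p) := fun n => by
  have : Module.Projective (H k p) ((GMod.regular k p).shift n) :=
    inferInstanceAs (Module.Projective (H k p) (H k p))
  have hzero := cls_eq_zero_of_projective ((GMod.regular k p).shift n)
  rw [cls_eq_weightedDim, GMod.weightedDim_shift, GMod.weightedDim_regular] at hzero
  simpa only [add_comm] using hzero

theorem K0Stable.addMonoidHom_ext {G : Type*} [AddCommGroup G] {f g : K0Stable k p →+ G}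
    (h : ∀ n, f (unitCls k p n) = g (unitCls k p n)) : f = g := by
  refine GrothendieckGroup.addMonoidHom_ext fun X => ?_
  change f (cls X.as) = g (cls X.as)
  have hfin := finite_ne_bot_of_isInternal X.as.isInternal
  rw [cls_eq_weightedDim, map_weightedDim hfin, map_weightedDim hfin, funext h]

end UnitClasses

section GradedDimension

variable (k : Type u) [Field k] (p : ℕ) [Fact p.Prime] [CharP k p]

/-- The graded dimension `∑ dim Mⁿ qⁿ` as an isomorphism from the Grothendieck group of the stable
category to the additive group of `R_p`. -/
def gradedDim : K0Stable k p ≃+ CycloRing p :=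
  AddMonoidHom.toAddEquiv (weightedDimHom (CycloRing.isBalanced_zpow p))
    (CycloRing.lift (isBalanced_unitCls k p))
    (K0Stable.addMonoidHom_ext fun n => by
      rw [AddMonoidHom.comp_apply, unitCls, weightedDimHom_cls, GMod.weightedDim_shift_unit,
        CycloRing.lift_zpow, AddMonoidHom.id_apply, unitCls])
    (CycloRing.addMonoidHom_ext fun n => by
      rw [AddMonoidHom.comp_apply, CycloRing.lift_q_pow, unitCls, weightedDimHom_cls,
        GMod.weightedDim_shift_unit, CycloRing.val_qUnit_zpow_natCast, AddMonoidHom.id_apply])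

variable {k p}

theorem gradedDim_cls (M : GMod k p) : gradedDim k p (cls M) =
    weightedDim (fun n => ((CycloRing.qUnit p ^ n : (CycloRing p)ˣ) : CycloRing p)) M.deg :=
  weightedDimHom_cls (CycloRing.isBalanced_zpow p) M

theorem gradedDim_unit : gradedDim k p (cls (GMod.unit k p)) = 1 := by
  rw [gradedDim_cls, GMod.weightedDim_unit, zpow_zero, Units.val_one]

theorem gradedDim_tensor (M N : GMod k p) :
    gradedDim k p (cls (M.tensor N)) = gradedDim k p (cls M) * gradedDim k p (cls N) := by
  simp only [gradedDim_cls]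
  exact GMod.weightedDim_tensor (fun i j => by rw [zpow_add, Units.val_mul]) M N

theorem gradedDim_shift (M : GMod k p) :
    gradedDim k p (cls (M.shift 1)) = CycloRing.q p * gradedDim k p (cls M) := by
  rw [gradedDim_cls, gradedDim_cls, GMod.weightedDim_shift]
  simp only [zpow_add_one, Units.val_mul, mul_comm, CycloRing.val_qUnit]
  exact (map_weightedDim (finite_ne_bot_of_isInternal M.isInternal) _
    (AddMonoidHom.mulLeft (CycloRing.q p))).symm

theorem K0Stable.addMonoidHom_ext_of_shift {G : Type*} [AddCommGroup G] {s : G → G}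
    (hs : Function.Injective s) {f g : K0Stable k p →+ G}
    (hunit : f (cls (GMod.unit k p)) = g (cls (GMod.unit k p)))
    (hf : ∀ M : GMod k p, f (cls (M.shift 1)) = s (f (cls M)))
    (hg : ∀ M : GMod k p, g (cls (M.shift 1)) = s (g (cls M))) : f = g := by
  have hsucc : ∀ φ : K0Stable k p →+ G, (∀ M : GMod k p, φ (cls (M.shift 1)) = s (φ (cls M))) →
      ∀ n, φ (unitCls k p (n + 1)) = s (φ (unitCls k p n)) := fun φ hφ n => by
    rw [← cls_shift_unit_shift, hφ, unitCls]
  refine K0Stable.addMonoidHom_ext fun n => ?_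
  induction n with
  | zero => rwa [← cls_unit]
  | succ n ih => rw [hsucc f hf, hsucc g hg, ih]
  | pred n ih =>
    refine hs ?_
    rw [← hsucc f hf, ← hsucc g hg, sub_add_cancel, ih]

end GradedDimension

end KStable

end

/-- The Grothendieck group of the stable category of finite-dimensional graded `H`-modules is
isomorphic to `R_p`, by a unique additive isomorphism that takes the class of the unit object to
`1`, tensor products to products and the grading shift `{1}` to multiplication by `q`. -/
theorem mainTheorem4 (p : ℕ) [Fact p.Prime] (k : Type u) [Field k] [CharP k p] :
    ∃! φ : KStable.K0Stable k p ≃+ KStable.CycloRing p,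
      φ (KStable.cls (KStable.GMod.unit k p)) = 1 ∧
      (∀ M N : KStable.GMod k p,
        φ (KStable.cls (KStable.GMod.tensor M N)) = φ (KStable.cls M) * φ (KStable.cls N)) ∧
      (∀ M : KStable.GMod k p,
        φ (KStable.cls (M.shift 1)) = KStable.CycloRing.q p * φ (KStable.cls M)) := by
  refine ⟨KStable.gradedDim k p,
    ⟨KStable.gradedDim_unit, KStable.gradedDim_tensor, KStable.gradedDim_shift⟩, ?_⟩
  rintro φ ⟨hunit, -, hshift⟩
  exact AddEquiv.toAddMonoidHom_injective (KStable.K0Stable.addMonoidHom_ext_of_shift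
    (KStable.CycloRing.qUnit p).isUnit.mul_right_injective
    (hunit.trans KStable.gradedDim_unit.symm) hshift KStable.gradedDim_shift)
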